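/- **Theorem (Concentration).** Let $\|\cdot\|$ be an arbitrary norm on $\mathbb{R}^d$. Let $\{Y_t\}_{t\ge 0}$ be a time-homogeneous Markov chain in a measurable space $\mathcal{Y}$, with arbitrary initial distribution and transition kernel $P$, that has a unique stationary distribution $d_{\mathcal{Y}}$ and mixes geometrically: there are constants $\varrho\in[0,1)$ and $C_{\mathrm{mix}}$ such that $\|P^n(y,\cdot)-d_{\mathcal{Y}}\|\le C_{\mathrm{mix}}\,\varrho^n$ for all $y\in\mathcal{Y}$ and $n\ge 0$, where $\|m\|=|m|(\mathcal{Y})$ is the total variation mass of a signed measure $m$ (for densities, $\int_{\mathcal{Y}}|P^n(y,y')-d_{\mathcal{Y}}(y')|\,dy'$). Let $H:\mathbb{R}^d\times\mathcal{Y}\to\mathbb{R}^d$ be measurable in its second argument, with $\sup_{y}\|H(0,y)\|<\infty$ and, for some finite $L_h$, $\|H(w,y)-H(w',y)\|\le L_h\|w-w'\|$ for all $w,w',y$. Let $h(w)=\mathbb{E}_{y\sim d_{\mathcal{Y}}}[H(w,y)]$ and assume that, for some $\kappa\in[0,1)$, $\|h(w)-h(w')\|\le\kappa\|w-w'\|$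 for all $w,w'$. Then $h$ has a unique fixed point $w_*$, and the following holds for every $\nu\in(0,1)$. There is a constant $\bar C_\alpha>0$ such that for every $C_\alpha\ge\bar C_\alpha$ and every $R$ there are deterministic constants $C,C'>0$ and an integer $C''\ge 0$ with the following property. Let $w_0$ be an initial point (deterministic, or random and such that $\{Y_t\}$ is a Markov chain with respect to a filtration $\{\mathcal{F}_t\}$ for which $w_0$ is $\mathcal{F}_0$-measurable) with $\|w_0\|\le R$ almost surely, and let $$w_{t+1}=w_t+\alpha_t\bigl(H(w_t,Y_{t+1})-w_t\bigr),\qquad \alpha_t=\frac{C_\alpha}{(t+3)\ln^{\nu}(t+3)},\qquad t\ge 0 .$$ Then for every $\delta\in(0,1)$, with probability at least $1-\delta$, simultaneously for all $t\ge 0$, $$\|w_t-w_*\|^2\le C\exp\left(-\frac{\ln^{1-\nu}(t+1)}{1-\nu}\right)\left[\log\frac1\delta+C'+\frac{\ln^{1-\nu}(t+1)}{1-\nu}\right]^{C''} .$$ -/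

import Mathlib

open MeasureTheory ProbabilityTheory

noncomputable section

/-- The `n`-step transition kernel `K ^ n` (power in the monoid of kernels under composition)
of a Markov kernel is Markov. -/
instance isMarkovKernel_pow {𝒴 : Type*} [MeasurableSpace 𝒴] (K : Kernel 𝒴 𝒴) [IsMarkovKernel K]
    (n : ℕ) : IsMarkovKernel (K ^ n) := by
  induction n with
  | zero =>
    rw [pow_zero]
    exact inferInstanceAs (IsMarkovKernel (Kernel.id : Kernel 𝒴 𝒴))
  | succ n ih =>
    rw [pow_succ]
    exact inferInstanceAs (IsMarkovKernel ((K ^ n) ∘ₖ K))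

/-- The total variation mass `|μ - ν|(𝒴)` of the difference of two finite measures. When `μ` and `ν`
have densities `p` and `q` with respect to a reference measure `dy`, this is `∫ |p(y) - q(y)| dy`. -/
def tvMass {𝒴 : Type*} [MeasurableSpace 𝒴] (μ ν : Measure 𝒴) [IsFiniteMeasure μ]
    [IsFiniteMeasure ν] : ℝ :=
  (μ.toSignedMeasure - ν.toSignedMeasure).totalVariation.real Set.univ

/-- The transition kernel `K` has `d` as its unique stationary distribution, and it mixes
geometrically, uniformly in the starting point. -/
structure GeometricallyMixing {𝒴 : Type*} [MeasurableSpace 𝒴] (K : Kernel 𝒴 𝒴) [IsMarkovKernel K]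
    (d : Measure 𝒴) [IsProbabilityMeasure d] : Prop where
  stationary : Kernel.Invariant K d
  unique : ∀ d' : Measure 𝒴, IsProbabilityMeasure d' → Kernel.Invariant K d' → d' = d
  mixing : ∃ C ρ : ℝ, 0 ≤ ρ ∧ ρ < 1 ∧
    ∀ (y : 𝒴) (n : ℕ), tvMass ((K ^ n) y) d ≤ C * ρ ^ n

/-- `Y 0, Y 1, …` is a time-homogeneous Markov chain with transition kernel `K` with respect to the
filtration `ℱ`, with an arbitrary initial distribution. -/
structure IsMarkovChain {Ω 𝒴 : Type*} [MeasurableSpace Ω] [MeasurableSpace 𝒴]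
    (μ : Measure Ω) (ℱ : Filtration ℕ ‹MeasurableSpace Ω›) (K : Kernel 𝒴 𝒴)
    (Y : ℕ → Ω → 𝒴) : Prop where
  adapted : ∀ t, Measurable[ℱ t] (Y t)
  transition : ∀ (t : ℕ) (B : Set 𝒴), MeasurableSet B →
    μ⟦Y (t + 1) ⁻¹' B | ℱ t⟧ =ᵐ[μ] fun ω => (K (Y t ω)).real B

/-- The mean operator `h(w) = 𝔼_{y ∼ d} [H(w, y)]`. -/
def meanOperator {E 𝒴 : Type*} [NormedAddCommGroup E] [NormedSpace ℝ E] [MeasurableSpace 𝒴]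
    (H : E → 𝒴 → E) (d : Measure 𝒴) (w : E) : E :=
  ∫ y, H w y ∂d

/-- The iterates `w_{t+1} = w_t + α_t (H(w_t, y_{t+1}) - w_t)` along a noise path `y`. -/
def saIterate {E 𝒴 : Type*} [NormedAddCommGroup E] [NormedSpace ℝ E]
    (H : E → 𝒴 → E) (α : ℕ → ℝ) (w₀ : E) (y : ℕ → 𝒴) : ℕ → E
  | 0 => w₀
  | t + 1 => saIterate H α w₀ y t +
      α t • (H (saIterate H α w₀ y t) (y (t + 1)) - saIterate H α w₀ y t)

/-- The learning rate `α_t = C_α / ((t + 3) ln^ν (t + 3))`. -/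
def logStepSize (Cα ν : ℝ) (t : ℕ) : ℝ :=
  Cα / (((t : ℝ) + 3) * Real.log ((t : ℝ) + 3) ^ ν)

/-- The exponent `ln^{1-ν}(t + 1) / (1 - ν)`. -/
def logExponent (ν : ℝ) (t : ℕ) : ℝ :=
  Real.log ((t : ℝ) + 1) ^ (1 - ν) / (1 - ν)

end

section Poisson

theorem integrable_of_bound {𝒴 E : Type*} [MeasurableSpace 𝒴]
    [NormedAddCommGroup E] {μ : Measure 𝒴} [IsFiniteMeasure μ] {f : 𝒴 → E}
    (hf : StronglyMeasurable f) {M : ℝ} (hM : ∀ y, ‖f y‖ ≤ M) : Integrable f μ :=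
  Integrable.of_bound hf.aestronglyMeasurable M (Filter.Eventually.of_forall hM)

variable {𝒴 : Type*} [MeasurableSpace 𝒴] {E : Type*} [NormedAddCommGroup E] [NormedSpace ℝ E]

theorem tvMass_nonneg (μ ν : Measure 𝒴) [IsFiniteMeasure μ] [IsFiniteMeasure ν] :
    0 ≤ tvMass μ ν := measureReal_nonneg

/-- Integrals of a bounded function against two measures differ by at most the bound times
the total variation mass of the difference. -/
theorem norm_integral_sub_integral_le_tvMass (μ ν : Measure 𝒴) [IsFiniteMeasure μ]
    [IsFiniteMeasure ν] {f : 𝒴 → E} (hf : StronglyMeasurable f) {M : ℝ} (hM : ∀ y, ‖f y‖ ≤ M) :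
    ‖∫ y, f y ∂μ - ∫ y, f y ∂ν‖ ≤ M * tvMass μ ν := by
  set s := μ.toSignedMeasure - ν.toSignedMeasure with hs
  set p := s.toJordanDecomposition.posPart with hp
  set n := s.toJordanDecomposition.negPart with hn
  have hpn : s = p.toSignedMeasure - n.toSignedMeasure :=
    (s.toSignedMeasure_toJordanDecomposition).symm
  have hsum : μ + n = ν + p := by
    rw [← Measure.toSignedMeasure_eq_toSignedMeasure_iff, Measure.toSignedMeasure_add,
      Measure.toSignedMeasure_add]
    have h := hs.symm.trans hpn
    rw [sub_eq_sub_iff_add_eq_add] at h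
    rw [h, add_comm]
  have hint : ∀ m : Measure 𝒴, IsFiniteMeasure m → Integrable f m := fun m _ =>
    integrable_of_bound hf hM
  have h1 : ∫ y, f y ∂(μ + n) = ∫ y, f y ∂(ν + p) := by rw [hsum]
  rw [integral_add_measure (hint _ inferInstance) (hint _ inferInstance),
    integral_add_measure (hint _ inferInstance) (hint _ inferInstance)] at h1
  have h2 : ∫ y, f y ∂μ - ∫ y, f y ∂ν = ∫ y, f y ∂p - ∫ y, f y ∂n := by
    rw [sub_eq_sub_iff_add_eq_add, h1, add_comm]
  have h3 : tvMass μ ν = p.real Set.univ + n.real Set.univ := by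
    unfold tvMass SignedMeasure.totalVariation
    rw [measureReal_add_apply]
  rw [h2, h3, mul_add]
  refine (norm_sub_le _ _).trans (add_le_add ?_ ?_)
  · exact norm_integral_le_of_norm_le_const (Filter.Eventually.of_forall hM)
  · exact norm_integral_le_of_norm_le_const (Filter.Eventually.of_forall hM)

/-- The solution of the Poisson equation `f - ∫ f ∂d = g - K g`. -/
noncomputable def poissonSolution (K : Kernel 𝒴 𝒴) (d : Measure 𝒴) (f : 𝒴 → E) (y : 𝒴) : E :=
  ∑' n : ℕ, (∫ z, f z ∂((K ^ n) y) - ∫ z, f z ∂d)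

variable {K : Kernel 𝒴 𝒴} [IsMarkovKernel K] {d : Measure 𝒴} [IsProbabilityMeasure d]
  {C ρ : ℝ}

theorem norm_poissonSolution_term_le
    (hC : ∀ (y : 𝒴) (n : ℕ), tvMass ((K ^ n) y) d ≤ C * ρ ^ n)
    {f : 𝒴 → E} (hf : StronglyMeasurable f) {M : ℝ} (hM0 : 0 ≤ M) (hM : ∀ y, ‖f y‖ ≤ M)
    (y : 𝒴) (n : ℕ) :
    ‖∫ z, f z ∂((K ^ n) y) - ∫ z, f z ∂d‖ ≤ M * C * ρ ^ n := by
  refine (norm_integral_sub_integral_le_tvMass _ _ hf hM).trans ?_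
  rw [mul_assoc]
  exact mul_le_mul_of_nonneg_left (hC y n) hM0

theorem summable_poissonSolution_bound (hρ0 : 0 ≤ ρ) (hρ1 : ρ < 1) (M : ℝ) :
    Summable fun n : ℕ => M * C * ρ ^ n :=
  (summable_geometric_of_lt_one hρ0 hρ1).mul_left _

theorem norm_poissonSolution_le (hρ0 : 0 ≤ ρ) (hρ1 : ρ < 1)
    (hC : ∀ (y : 𝒴) (n : ℕ), tvMass ((K ^ n) y) d ≤ C * ρ ^ n)
    {f : 𝒴 → E} (hf : StronglyMeasurable f) {M : ℝ} (hM0 : 0 ≤ M) (hM : ∀ y, ‖f y‖ ≤ M)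
    (y : 𝒴) : ‖poissonSolution K d f y‖ ≤ C * (1 - ρ)⁻¹ * M := by
  have h := tsum_of_norm_bounded
    ((hasSum_geometric_of_lt_one hρ0 hρ1).mul_left (M * C))
    (norm_poissonSolution_term_le hC hf hM0 hM y)
  calc _ ≤ _ := h
    _ = _ := by ring

theorem poissonSolution_sub [CompleteSpace E] (hρ0 : 0 ≤ ρ) (hρ1 : ρ < 1)
    (hC : ∀ (y : 𝒴) (n : ℕ), tvMass ((K ^ n) y) d ≤ C * ρ ^ n)
    {f g : 𝒴 → E} (hf : StronglyMeasurable f) (hg : StronglyMeasurable g) {M N : ℝ}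
    (hM0 : 0 ≤ M) (hM : ∀ y, ‖f y‖ ≤ M) (hN0 : 0 ≤ N) (hN : ∀ y, ‖g y‖ ≤ N) (y : 𝒴) :
    poissonSolution K d f y - poissonSolution K d g y =
      poissonSolution K d (fun z => f z - g z) y := by
  unfold poissonSolution
  rw [← Summable.tsum_sub]
  · congr 1
    ext n
    rw [integral_sub (integrable_of_bound hf hM) (integrable_of_bound hg hN),
      integral_sub (integrable_of_bound hf hM) (integrable_of_bound hg hN)]
    abel
  · exact Summable.of_norm_bounded (summable_poissonSolution_bound hρ0 hρ1 M)
      (norm_poissonSolution_term_le hC hf hM0 hM y)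
  · exact Summable.of_norm_bounded (summable_poissonSolution_bound hρ0 hρ1 N)
      (norm_poissonSolution_term_le hC hg hN0 hN y)

theorem stronglyMeasurable_poissonSolution [CompleteSpace E] (hρ0 : 0 ≤ ρ) (hρ1 : ρ < 1)
    (hC : ∀ (y : 𝒴) (n : ℕ), tvMass ((K ^ n) y) d ≤ C * ρ ^ n)
    {f : 𝒴 → E} (hf : StronglyMeasurable f) {M : ℝ} (hM0 : 0 ≤ M) (hM : ∀ y, ‖f y‖ ≤ M) :
    StronglyMeasurable (poissonSolution K d f) := by
  refine stronglyMeasurable_of_tendsto Filter.atTop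
    (f := fun N y => ∑ n ∈ Finset.range N, (∫ z, f z ∂((K ^ n) y) - ∫ z, f z ∂d)) ?_ ?_
  · intro N
    refine Finset.stronglyMeasurable_fun_sum _ fun n _ => ?_
    exact hf.integral_kernel.sub stronglyMeasurable_const
  · rw [tendsto_pi_nhds]
    intro y
    exact (Summable.of_norm_bounded (summable_poissonSolution_bound hρ0 hρ1 M)
      (norm_poissonSolution_term_le hC hf hM0 hM y)).hasSum.tendsto_sum_nat

theorem poissonSolution_eq [CompleteSpace E] (hρ0 : 0 ≤ ρ) (hρ1 : ρ < 1)
    (hC : ∀ (y : 𝒴) (n : ℕ), tvMass ((K ^ n) y) d ≤ C * ρ ^ n)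
    {f : 𝒴 → E} (hf : StronglyMeasurable f) {M : ℝ} (hM0 : 0 ≤ M) (hM : ∀ y, ‖f y‖ ≤ M)
    (y : 𝒴) :
    f y - ∫ z, f z ∂d = poissonSolution K d f y - ∫ z, poissonSolution K d f z ∂(K y) := by
  have hterm := norm_poissonSolution_term_le hC hf hM0 hM
  have hsm : ∀ n : ℕ, StronglyMeasurable fun y => ∫ z, f z ∂((K ^ n) y) - ∫ z, f z ∂d :=
    fun n => hf.integral_kernel.sub stronglyMeasurable_const
  have hint : ∀ n : ℕ, Integrable (fun y => ∫ z, f z ∂((K ^ n) y) - ∫ z, f z ∂d) (K y) :=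
    fun n => integrable_of_bound (hsm n) (fun y => hterm y n)
  have hsum : Summable fun n : ℕ => ∫ z, f z ∂((K ^ n) y) - ∫ z, f z ∂d :=
    Summable.of_norm_bounded (summable_poissonSolution_bound hρ0 hρ1 M) (hterm y)
  have hK : ∫ z, poissonSolution K d f z ∂(K y) =
      ∑' n : ℕ, (∫ z, f z ∂((K ^ (n + 1)) y) - ∫ z, f z ∂d) := by
    unfold poissonSolution
    rw [← integral_tsum_of_summable_integral_norm hint]
    · congr 1
      ext n
      have hk : ∀ m : ℕ, Integrable (fun y => ∫ z, f z ∂((K ^ m) y)) (K y) := fun m =>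
        integrable_of_bound (M := M) hf.integral_kernel fun y =>
          (norm_integral_le_of_norm_le_const (Filter.Eventually.of_forall hM)).trans_eq (by simp)
      have hc : ∫ z, f z ∂((K ^ (n + 1)) y) = ∫ x, ∫ z, f z ∂((K ^ n) x) ∂(K y) := by
        have : K ^ (n + 1) = (K ^ n) ∘ₖ K := pow_succ K n
        rw [this]
        exact Kernel.integral_comp (integrable_of_bound hf hM)
      rw [integral_sub (hk n) (integrable_const _), hc]
      simp
    · refine Summable.of_nonneg_of_le (fun n => integral_nonneg fun _ => norm_nonneg _)
        (fun n => ?_) (summable_poissonSolution_bound (C := C) hρ0 hρ1 M)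
      refine (integral_mono_of_nonneg (Filter.Eventually.of_forall fun _ => norm_nonneg _)
        (integrable_const (M * C * ρ ^ n))
        (Filter.Eventually.of_forall fun z => hterm z n)).trans_eq (by simp)
  have h0 : ∫ z, f z ∂((K ^ 0) y) = f y := by
    have : (K ^ 0) y = Measure.dirac y := by
      rw [pow_zero]; exact Kernel.id_apply y
    rw [this, integral_dirac' _ _ hf]
  rw [hK, poissonSolution, hsum.tsum_eq_zero_add, h0]
  abel

/-- A jointly controlled solution of the Poisson equation for a Lipschitz family of noise
functions. -/
theorem exists_poisson_family [CompleteSpace E] (hmix : GeometricallyMixing K d)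
    {H : E → 𝒴 → E} (hmeas : ∀ w, StronglyMeasurable (H w)) {L G : ℝ} (hL0 : 0 ≤ L)
    (hlip : ∀ (w w' : E) (y : 𝒴), ‖H w y - H w' y‖ ≤ L * ‖w - w'‖)
    (hG : ∀ y, ‖H 0 y‖ ≤ G) (hG0 : 0 ≤ G) :
    ∃ (ψ : E → 𝒴 → E) (A : ℝ), 0 ≤ A ∧ (∀ w, StronglyMeasurable (ψ w)) ∧
      (∀ w w' y, ‖ψ w y - ψ w' y‖ ≤ A * ‖w - w'‖) ∧
      (∀ w y, ‖ψ w y‖ ≤ A * (1 + ‖w‖)) ∧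
      (∀ w y, H w y - meanOperator H d w = ψ w y - ∫ z, ψ w z ∂(K y)) := by
  obtain ⟨C, ρ, hρ0, hρ1, hC⟩ := hmix.mixing
  have hne : Nonempty 𝒴 := d.nonempty_of_neZero
  have hC0 : 0 ≤ C := by
    have := (tvMass_nonneg _ _).trans (hC (Classical.arbitrary 𝒴) 0)
    simpa using this
  obtain ⟨B, hB⟩ : ∃ B, B = C * (1 - ρ)⁻¹ := ⟨_, rfl⟩
  have hB0 : 0 ≤ B := hB ▸ mul_nonneg hC0 (inv_nonneg.2 (by linarith))
  have hbd : ∀ w y, ‖H w y‖ ≤ G + L * ‖w‖ := fun w y => by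
    have h1 := hlip w 0 y
    have h2 := norm_le_norm_add_norm_sub' (H w y) (H 0 y)
    rw [sub_zero] at h1
    linarith [hG y]
  have hbd0 : ∀ w : E, 0 ≤ G + L * ‖w‖ := fun w => by positivity
  refine ⟨fun w => poissonSolution K d (H w), B * (L + G), by positivity, fun w =>
    stronglyMeasurable_poissonSolution hρ0 hρ1 hC (hmeas w) (hbd0 w) (hbd w), ?_, ?_, ?_⟩
  · intro w w' y
    rw [poissonSolution_sub hρ0 hρ1 hC (hmeas w) (hmeas w') (hbd0 w) (hbd w) (hbd0 w') (hbd w')]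
    refine (norm_poissonSolution_le hρ0 hρ1 hC ((hmeas w).sub (hmeas w'))
      (by positivity : 0 ≤ L * ‖w - w'‖) (hlip w w') y).trans ?_
    rw [← hB, mul_assoc]
    exact mul_le_mul_of_nonneg_left
      (mul_le_mul_of_nonneg_right (by linarith) (norm_nonneg _)) hB0
  · intro w y
    refine (norm_poissonSolution_le hρ0 hρ1 hC (hmeas w) (hbd0 w) (hbd w) y).trans ?_
    rw [← hB, mul_assoc]
    gcongr
    nlinarith [mul_nonneg hG0 (norm_nonneg w)]
  · intro w y
    exact poissonSolution_eq hρ0 hρ1 hC (hmeas w) (hbd0 w) (hbd w) y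

end Poisson

section Concentration

theorem lintegral_pair_of_rectangles {Ω Ω' 𝒴 : Type*} [MeasurableSpace Ω] [MeasurableSpace Ω']
    [MeasurableSpace 𝒴] {μ : Measure Ω} [IsProbabilityMeasure μ] {X : Ω → Ω'} (hX : Measurable X)
    {Z : Ω → 𝒴} (hZ : Measurable Z) {κ : Kernel Ω' 𝒴} [IsMarkovKernel κ]
    (h : ∀ (s : Set Ω') (B : Set 𝒴), MeasurableSet s → MeasurableSet B →
      μ (X ⁻¹' s ∩ Z ⁻¹' B) = ∫⁻ ω in X ⁻¹' s, κ (X ω) B ∂μ)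
    {F : Ω' × 𝒴 → ENNReal} (hF : Measurable F) :
    ∫⁻ ω, F (X ω, Z ω) ∂μ = ∫⁻ ω, ∫⁻ y, F (X ω, y) ∂(κ (X ω)) ∂μ := by
  have hmap : μ.map (fun ω => (X ω, Z ω)) = (μ.map X) ⊗ₘ κ := by
    have : IsProbabilityMeasure (μ.map fun ω => (X ω, Z ω)) :=
      Measure.isProbabilityMeasure_map (hX.prodMk hZ).aemeasurable
    have : IsProbabilityMeasure (μ.map X) := Measure.isProbabilityMeasure_map hX.aemeasurable
    refine Measure.ext_prod fun {s B} hs hB => ?_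
    rw [Measure.map_apply (hX.prodMk hZ) (hs.prod hB), Measure.compProd_apply_prod hs hB,
      setLIntegral_map hs (κ.measurable_coe hB) hX, ← h s B hs hB]
    rfl
  have : IsProbabilityMeasure (μ.map X) := Measure.isProbabilityMeasure_map hX.aemeasurable
  rw [← lintegral_map hF (hX.prodMk hZ), hmap, Measure.lintegral_compProd hF,
    lintegral_map hF.lintegral_kernel_prod_right' hX]

theorem measurable_integral_kernel_comp {Ω 𝒴 : Type*} [MeasurableSpace Ω] [MeasurableSpace 𝒴]
    {K : Kernel 𝒴 𝒴} [IsMarkovKernel K] {Z : Ω → 𝒴} (hZ : Measurable Z) {g : Ω → 𝒴 → ℝ}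
    (hg : Measurable (Function.uncurry g)) : Measurable fun ω => ∫ y, g ω y ∂(K (Z ω)) :=
  (StronglyMeasurable.integral_kernel_prod_right (κ := K.comap Z hZ)
    hg.stronglyMeasurable).measurable

/-- The Chernoff bound. -/
theorem measure_ge_le_of_lintegral_exp_le {Ω : Type*} [MeasurableSpace Ω]
    {μ : Measure Ω} {m : Ω → ℝ} (hm : Measurable m) {V W : ℝ} (hVW : V ≤ W)
    (hW : 0 < W)
    (h : ∀ l : ℝ, ∫⁻ ω, ENNReal.ofReal (Real.exp (l * m ω)) ∂μ ≤
      ENNReal.ofReal (Real.exp (l ^ 2 * V / 2))) {x : ℝ} (hx : 0 ≤ x) :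
    μ {ω | x ≤ m ω} ≤ ENNReal.ofReal (Real.exp (-(x ^ 2 / (2 * W)))) := by
  set l := x / W with hl
  have hl0 : 0 ≤ l := div_nonneg hx hW.le
  have hmk := mul_meas_ge_le_lintegral₀ (μ := μ)
    (f := fun ω => ENNReal.ofReal (Real.exp (l * m ω))) (by fun_prop)
    (ENNReal.ofReal (Real.exp (l * x)))
  have hsub : μ {ω | x ≤ m ω} ≤ μ {ω | ENNReal.ofReal (Real.exp (l * x)) ≤
      ENNReal.ofReal (Real.exp (l * m ω))} := by
    refine measure_mono fun ω hω => ENNReal.ofReal_le_ofReal (Real.exp_le_exp.2 ?_)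
    exact mul_le_mul_of_nonneg_left hω hl0
  have hpos : ENNReal.ofReal (Real.exp (-(l * x))) * ENNReal.ofReal (Real.exp (l * x)) = 1 := by
    rw [← ENNReal.ofReal_mul (Real.exp_pos _).le, ← Real.exp_add]
    simp
  calc μ {ω | x ≤ m ω}
      = ENNReal.ofReal (Real.exp (-(l * x))) *
          (ENNReal.ofReal (Real.exp (l * x)) * μ {ω | x ≤ m ω}) := by
        rw [← mul_assoc, hpos, one_mul]
    _ ≤ ENNReal.ofReal (Real.exp (-(l * x))) * ENNReal.ofReal (Real.exp (l ^ 2 * V / 2)) := by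
        gcongr
        exact (mul_le_mul_right hsub _).trans (hmk.trans (h l))
    _ = ENNReal.ofReal (Real.exp (-(l * x) + l ^ 2 * V / 2)) := by
        rw [← ENNReal.ofReal_mul (Real.exp_pos _).le, ← Real.exp_add]
    _ ≤ _ := by
        refine ENNReal.ofReal_le_ofReal (Real.exp_le_exp.2 ?_)
        have h1 : l ^ 2 * V ≤ l ^ 2 * W := mul_le_mul_of_nonneg_left hVW (sq_nonneg l)
        have h2 : -(x ^ 2 / (2 * W)) = -(l * x) + l ^ 2 * W / 2 := by
          rw [hl]; field_simp; ring
        linarith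

variable {Ω 𝒴 : Type*} [mΩ : MeasurableSpace Ω] [m𝒴 : MeasurableSpace 𝒴] {μ : Measure Ω}
  [IsProbabilityMeasure μ] {ℱ : Filtration ℕ ‹MeasurableSpace Ω›} {K : Kernel 𝒴 𝒴}
  [IsMarkovKernel K] {Y : ℕ → Ω → 𝒴}

theorem IsMarkovChain.measure_inter (h : IsMarkovChain μ ℱ K Y) (t : ℕ) {A : Set Ω}
    (hA : MeasurableSet[ℱ t] A) {B : Set 𝒴} (hB : MeasurableSet B) :
    μ (A ∩ Y (t + 1) ⁻¹' B) = ∫⁻ ω in A, K (Y t ω) B ∂μ := by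
  have hYt : Measurable (Y t) := (h.adapted t).mono (ℱ.le t) le_rfl
  have hYs : Measurable (Y (t + 1)) := (h.adapted (t + 1)).mono (ℱ.le _) le_rfl
  have hAm : MeasurableSet A := ℱ.le t A hA
  have hKm : Measurable fun ω => K (Y t ω) B := (K.measurable_coe hB).comp hYt
  have h1 : ∫ ω in A, (Y (t + 1) ⁻¹' B).indicator (fun _ => (1 : ℝ)) ω ∂μ =
      ∫ ω in A, (K (Y t ω)).real B ∂μ := by
    rw [← setIntegral_condExp (ℱ.le t)
      ((integrable_const (1 : ℝ)).indicator (hYs hB)) hA]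
    exact integral_congr_ae (ae_restrict_of_ae (h.transition t B hB))
  rw [integral_indicator (hYs hB), setIntegral_const, Measure.real,
    Measure.restrict_apply (hYs hB), smul_eq_mul, mul_one] at h1
  have h2 : ∫ ω in A, (K (Y t ω)).real B ∂μ = (∫⁻ ω in A, K (Y t ω) B ∂μ).toReal :=
    integral_toReal hKm.aemeasurable (Filter.Eventually.of_forall fun ω => measure_lt_top _ _)
  have h3 : ∫⁻ ω in A, K (Y t ω) B ∂μ ≠ ⊤ := by
    refine ((lintegral_mono (g := fun _ => (1 : ENNReal)) fun ω => prob_le_one).trans_lt ?_).ne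
    simp
  rw [Set.inter_comm]
  exact (ENNReal.toReal_eq_toReal_iff' (measure_ne_top _ _) h3).1 (h1.trans h2)

theorem IsMarkovChain.lintegral_next (h : IsMarkovChain μ ℱ K Y) (t : ℕ)
    {F : Ω × 𝒴 → ENNReal} (hF : Measurable[(ℱ t).prod m𝒴] F) :
    ∫⁻ ω, F (ω, Y (t + 1) ω) ∂μ = ∫⁻ ω, ∫⁻ y, F (ω, y) ∂(K (Y t ω)) ∂μ := by
  have hY' : Measurable (Y (t + 1)) := (h.adapted (t + 1)).mono (ℱ.le _) le_rfl
  have hid : @Measurable Ω Ω mΩ (ℱ t) id := measurable_id'' (ℱ.le t)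
  exact @lintegral_pair_of_rectangles Ω Ω 𝒴 mΩ (ℱ t) m𝒴 μ _ id hid (Y (t + 1)) hY'
    (@Kernel.comap 𝒴 𝒴 m𝒴 m𝒴 Ω (ℱ t) K (Y t) (h.adapted t))
    (@Kernel.IsMarkovKernel.comap 𝒴 𝒴 m𝒴 m𝒴 Ω (ℱ t) (Y t) K _ (h.adapted t))
    (fun s B hs hB => h.measure_inter t hs hB) F hF

/-- Hoeffding's lemma for the lower Lebesgue integral. -/
theorem lintegral_exp_sub_integral_le {P : Measure 𝒴} [IsProbabilityMeasure P] {f : 𝒴 → ℝ}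
    (hf : Measurable f) {c : ℝ} (hc : ∀ y, |f y| ≤ c) (l : ℝ) :
    ∫⁻ y, ENNReal.ofReal (Real.exp (l * (f y - ∫ z, f z ∂P))) ∂P ≤
      ENNReal.ofReal (Real.exp (l ^ 2 * c ^ 2 / 2)) := by
  have hsg := hasSubgaussianMGF_of_mem_Icc (μ := P) (a := -c) (b := c) hf.aemeasurable
    (Filter.Eventually.of_forall fun y => abs_le.1 (hc y))
  rw [← ofReal_integral_eq_lintegral_ofReal (hsg.integrable_exp_mul l)
    (Filter.Eventually.of_forall fun _ => (Real.exp_pos _).le)]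
  refine ENNReal.ofReal_le_ofReal ((hsg.mgf_le l).trans_eq ?_)
  congr 1
  push_cast
  rw [Real.norm_eq_abs, div_pow, sq_abs]
  ring

theorem IsMarkovChain.lintegral_exp_le (h : IsMarkovChain μ ℱ K Y) {m : ℕ → Ω → ℝ}
    {g : ℕ → Ω → 𝒴 → ℝ} {p q c V : ℕ → ℝ} (hm : ∀ t, Measurable[ℱ t] (m t))
    (hg : ∀ t, Measurable[(ℱ t).prod m𝒴] (Function.uncurry (g t)))
    (hc : ∀ t ω y, |g t ω y| ≤ c t) (h0 : ∀ ω, m 0 ω = 0)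
    (hrec : ∀ t ω, m (t + 1) ω =
      p t * m t ω + q t * (g t ω (Y (t + 1) ω) - ∫ y, g t ω y ∂(K (Y t ω))))
    (hV0 : V 0 = 0) (hV : ∀ t, V (t + 1) = p t ^ 2 * V t + q t ^ 2 * c t ^ 2) (t : ℕ) (l : ℝ) :
    ∫⁻ ω, ENNReal.ofReal (Real.exp (l * m t ω)) ∂μ ≤
      ENNReal.ofReal (Real.exp (l ^ 2 * V t / 2)) := by
  induction t generalizing l with
  | zero => simp [h0, hV0]
  | succ t ih =>
    have hI : Measurable[ℱ t] fun ω => ∫ y, g t ω y ∂(K (Y t ω)) :=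
      @measurable_integral_kernel_comp Ω 𝒴 (ℱ t) m𝒴 K _ (Y t) (h.adapted t) (g t) (hg t)
    have hfst : @Measurable (Ω × 𝒴) Ω ((ℱ t).prod m𝒴) (ℱ t) Prod.fst :=
      @measurable_fst Ω 𝒴 (ℱ t) m𝒴
    have hF : Measurable[(ℱ t).prod m𝒴] fun x : Ω × 𝒴 => ENNReal.ofReal (Real.exp
        (l * (p t * m t x.1 + q t * (g t x.1 x.2 - ∫ y, g t x.1 y ∂(K (Y t x.1)))))) := by
      have h1 := (hm t).comp hfst
      have h2 := hI.comp hfst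
      have h3 := ((h1.const_mul (p t)).add (((hg t).sub h2).const_mul (q t))).const_mul l
      exact (Real.measurable_exp.comp h3).ennreal_ofReal
    calc ∫⁻ ω, ENNReal.ofReal (Real.exp (l * m (t + 1) ω)) ∂μ
        = ∫⁻ ω, ∫⁻ y, ENNReal.ofReal (Real.exp (l * (p t * m t ω +
            q t * (g t ω y - ∫ y, g t ω y ∂(K (Y t ω)))))) ∂(K (Y t ω)) ∂μ := by
          simp_rw [hrec]
          exact h.lintegral_next t hF
      _ ≤ ∫⁻ ω, ENNReal.ofReal (Real.exp ((l * p t) * m t ω)) *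
            ENNReal.ofReal (Real.exp ((l * q t) ^ 2 * c t ^ 2 / 2)) ∂μ := by
          refine lintegral_mono fun ω => ?_
          have hgm : Measurable (g t ω) := (hg t).comp (@measurable_prodMk_left Ω 𝒴 (ℱ t) m𝒴 ω)
          have hsplit : ∀ y, ENNReal.ofReal (Real.exp (l * (p t * m t ω +
              q t * (g t ω y - ∫ y, g t ω y ∂(K (Y t ω)))))) =
              ENNReal.ofReal (Real.exp ((l * p t) * m t ω)) * ENNReal.ofReal
                (Real.exp ((l * q t) * (g t ω y - ∫ y, g t ω y ∂(K (Y t ω))))) := fun y => by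
            rw [← ENNReal.ofReal_mul (Real.exp_pos _).le, ← Real.exp_add]
            congr 2
            ring
          simp_rw [hsplit]
          rw [lintegral_const_mul' _ _ ENNReal.ofReal_ne_top]
          gcongr
          exact lintegral_exp_sub_integral_le hgm (hc t ω) (l * q t)
      _ ≤ ENNReal.ofReal (Real.exp ((l * p t) ^ 2 * V t / 2)) *
            ENNReal.ofReal (Real.exp ((l * q t) ^ 2 * c t ^ 2 / 2)) := by
          rw [lintegral_mul_const' _ _ ENNReal.ofReal_ne_top]
          gcongr
          exact ih (l * p t)
      _ = ENNReal.ofReal (Real.exp (l ^ 2 * V (t + 1) / 2)) := by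
          rw [← ENNReal.ofReal_mul (Real.exp_pos _).le, ← Real.exp_add, hV]
          congr 2
          ring

end Concentration

section StepSizes

variable {ν : ℝ}

theorem one_le_log_add_three (t : ℕ) : 1 ≤ Real.log ((t : ℝ) + 3) := by
  rw [Real.le_log_iff_exp_le (by positivity)]
  have := Real.exp_one_lt_d9
  have h : (0 : ℝ) ≤ t := t.cast_nonneg
  linarith

theorem logExponent_nonneg (hν1 : ν < 1) (t : ℕ) : 0 ≤ logExponent ν t := by
  have : 0 ≤ Real.log ((t : ℝ) + 1) := Real.log_nonneg (by simp)
  unfold logExponent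
  exact div_nonneg (Real.rpow_nonneg this _) (by linarith)

theorem logExponent_zero (hν1 : ν < 1) : logExponent ν 0 = 0 := by
  simp [logExponent, Real.zero_rpow (by linarith : 1 - ν ≠ 0)]

theorem exists_logExponent_sub_eq (hν1 : ν < 1) (t : ℕ) :
    ∃ x : ℝ, (t : ℝ) + 1 < x ∧ x < t + 2 ∧
      logExponent ν (t + 1) - logExponent ν t = (x * Real.log x ^ ν)⁻¹ := by
  have ht : (0 : ℝ) ≤ t := t.cast_nonneg
  have hlt : (t : ℝ) + 1 < t + 2 := by linarith
  obtain ⟨x, ⟨hx1, hx2⟩, hx⟩ := exists_hasDerivAt_eq_slope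
    (fun x : ℝ => Real.log x ^ (1 - ν) / (1 - ν)) (fun x => (x * Real.log x ^ ν)⁻¹) hlt
    (by
      refine ContinuousOn.div_const (ContinuousOn.rpow_const ?_ fun x _ => Or.inr (by linarith)) _
      exact Real.continuousOn_log.mono fun x hx => by
        have := hx.1
        simp only [Set.mem_compl_iff, Set.mem_singleton_iff]
        linarith)
    (by
      intro x hx
      have h1 : 1 < x := by linarith [hx.1]
      have hlog : 0 < Real.log x := Real.log_pos h1
      have hd := ((Real.hasDerivAt_log (by linarith : x ≠ 0)).rpow_const (p := 1 - ν)
        (Or.inl hlog.ne')).div_const (1 - ν)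
      refine hd.congr_deriv (Eq.symm ?_)
      have : (1 - ν - 1) = -ν := by ring
      rw [this, Real.rpow_neg hlog.le]
      have h3 : Real.log x ^ ν ≠ 0 := (Real.rpow_pos_of_pos hlog _).ne'
      have h4 : (1 - ν) ≠ 0 := by linarith
      field_simp)
  refine ⟨x, hx1, hx2, ?_⟩
  rw [hx]
  unfold logExponent
  push_cast
  have : (t : ℝ) + 2 - (t + 1) = 1 := by ring
  rw [this, div_one]
  congr 4
  ring

theorem logStepSize_eq (c : ℝ) (t : ℕ) :
    logStepSize c ν t = c * (((t : ℝ) + 3) * Real.log ((t : ℝ) + 3) ^ ν)⁻¹ :=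
  div_eq_mul_inv _ _

theorem logStepSize_eq_mul (c : ℝ) (t : ℕ) : logStepSize c ν t = c * logStepSize 1 ν t := by
  rw [logStepSize_eq, logStepSize_eq 1, one_mul]

theorem logStepSize_one_pos (t : ℕ) : 0 < logStepSize 1 ν t := by
  have := one_le_log_add_three t
  unfold logStepSize
  have := Real.rpow_pos_of_pos (by linarith : 0 < Real.log ((t : ℝ) + 3)) ν
  positivity

theorem logStepSize_one_le (hν0 : 0 < ν) (t : ℕ) : logStepSize 1 ν t ≤ 1 / ((t : ℝ) + 3) := by
  unfold logStepSize
  have h := Real.one_le_rpow (one_le_log_add_three t) hν0.le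
  have ht : (0 : ℝ) ≤ t := t.cast_nonneg
  gcongr
  nlinarith

theorem logStepSize_one_le_sub (hν0 : 0 < ν) (hν1 : ν < 1) (t : ℕ) :
    logStepSize 1 ν t ≤ logExponent ν (t + 1) - logExponent ν t := by
  obtain ⟨x, hx1, hx2, hx⟩ := exists_logExponent_sub_eq hν1 t
  have ht : (0 : ℝ) ≤ t := t.cast_nonneg
  have hlog : 0 < Real.log x := Real.log_pos (by linarith)
  rw [hx, logStepSize_eq, one_mul]
  have := Real.rpow_pos_of_pos hlog ν
  have hx0 : 0 < x := by linarith
  have hx3 : x ≤ (t : ℝ) + 3 := by linarith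
  gcongr

theorem sub_le_logStepSize_one (hν0 : 0 < ν) (hν1 : ν < 1) {t : ℕ} (ht : 1 ≤ t) :
    logExponent ν (t + 1) - logExponent ν t ≤ 4 * logStepSize 1 ν t := by
  obtain ⟨x, hx1, hx2, hx⟩ := exists_logExponent_sub_eq hν1 t
  have ht : (1 : ℝ) ≤ t := by exact_mod_cast ht
  have hlog0 : 0 < Real.log ((t : ℝ) + 1) := Real.log_pos (by linarith)
  have hlog : 0 < Real.log x := Real.log_pos (by linarith)
  have hxp := Real.rpow_pos_of_pos hlog ν
  have h1 : Real.log ((t : ℝ) + 3) ≤ 2 * Real.log x := by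
    rw [← Real.log_rpow (by linarith)]
    apply Real.log_le_log (by linarith)
    have : x ^ (2 : ℝ) = x ^ 2 := Real.rpow_natCast x 2
    rw [this]
    nlinarith
  have h2 : Real.log ((t : ℝ) + 3) ^ ν ≤ 2 * Real.log x ^ ν := by
    calc Real.log ((t : ℝ) + 3) ^ ν ≤ (2 * Real.log x) ^ ν :=
          Real.rpow_le_rpow (by linarith [one_le_log_add_three t]) h1 hν0.le
      _ = 2 ^ ν * Real.log x ^ ν := Real.mul_rpow (by norm_num) hlog.le
      _ ≤ 2 * Real.log x ^ ν := by
          gcongr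
          calc (2 : ℝ) ^ ν ≤ 2 ^ (1 : ℝ) := Real.rpow_le_rpow_of_exponent_le (by norm_num) hν1.le
            _ = 2 := Real.rpow_one 2
  have h3 : 0 < Real.log ((t : ℝ) + 3) ^ ν :=
    Real.rpow_pos_of_pos (by linarith [one_le_log_add_three t]) ν
  have h4 : ((t : ℝ) + 3) * Real.log ((t : ℝ) + 3) ^ ν ≤ 4 * (x * Real.log x ^ ν) := by
    calc ((t : ℝ) + 3) * Real.log ((t : ℝ) + 3) ^ ν ≤ (2 * x) * (2 * Real.log x ^ ν) :=
          mul_le_mul (by linarith) h2 h3.le (by linarith)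
      _ = _ := by ring
  rw [hx, logStepSize_eq, one_mul, ← div_eq_mul_inv, inv_eq_one_div, div_le_div_iff₀ (by
    have : 0 < x := by linarith
    positivity) (by positivity)]
  linarith

theorem logExponent_monotone (hν0 : 0 < ν) (hν1 : ν < 1) : Monotone (logExponent ν) :=
  monotone_nat_of_le_succ fun t => by
    have := logStepSize_one_le_sub hν0 hν1 t
    linarith [logStepSize_one_pos (ν := ν) t]

theorem logStepSize_one_antitone_step (hν0 : 0 < ν) (t : ℕ) :
    logStepSize 1 ν (t + 1) ≤ logStepSize 1 ν t := by
  rw [logStepSize_eq, logStepSize_eq]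
  have h1 := one_le_log_add_three t
  have h3 : 0 < Real.log ((t : ℝ) + 3) ^ ν := Real.rpow_pos_of_pos (by linarith) ν
  push_cast
  gcongr <;> linarith

theorem logStepSize_one_sub_le (hν0 : 0 < ν) (hν1 : ν < 1) (t : ℕ) :
    logStepSize 1 ν t - logStepSize 1 ν (t + 1) ≤ 2 / ((t : ℝ) + 3) * logStepSize 1 ν t := by
  have ht : (0 : ℝ) ≤ t := t.cast_nonneg
  have hl3 := one_le_log_add_three t
  have hl4 : 1 ≤ Real.log ((t : ℝ) + 4) := hl3.trans (Real.log_le_log (by linarith) (by linarith))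
  have hp3 : 0 < Real.log ((t : ℝ) + 3) ^ ν := Real.rpow_pos_of_pos (by linarith) ν
  have hp4 : 0 < Real.log ((t : ℝ) + 4) ^ ν := Real.rpow_pos_of_pos (by linarith) ν
  have hratio : ((t : ℝ) + 3) / (t + 4) ≤ Real.log ((t : ℝ) + 3) / Real.log ((t : ℝ) + 4) := by
    have he : Real.exp 1 ≤ (t : ℝ) + 3 := by
      rwa [← Real.le_log_iff_exp_le (by positivity)]
    have := Real.log_div_self_antitoneOn (a := (t : ℝ) + 3) (b := (t : ℝ) + 4) he
      (he.trans (by linarith)) (by linarith)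
    dsimp only at this
    rw [div_le_div_iff₀ (by linarith) (by linarith)] at this ⊢
    linarith
  have hpow : Real.log ((t : ℝ) + 3) / Real.log ((t : ℝ) + 4) ≤
      Real.log ((t : ℝ) + 3) ^ ν / Real.log ((t : ℝ) + 4) ^ ν := by
    rw [← Real.div_rpow (by linarith) (by linarith)]
    have h1 : Real.log ((t : ℝ) + 3) / Real.log ((t : ℝ) + 4) ≤ 1 := by
      rw [div_le_one (by linarith)]
      exact Real.log_le_log (by linarith) (by linarith)
    calc _ = (Real.log ((t : ℝ) + 3) / Real.log ((t : ℝ) + 4)) ^ (1 : ℝ) := (Real.rpow_one _).symm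
      _ ≤ _ := Real.rpow_le_rpow_of_exponent_ge (by apply div_pos <;> linarith) h1 hν1.le
  have hq : logStepSize 1 ν (t + 1) = logStepSize 1 ν t * (((t : ℝ) + 3) / (t + 4) *
      (Real.log ((t : ℝ) + 3) ^ ν / Real.log ((t : ℝ) + 4) ^ ν)) := by
    rw [logStepSize_eq, logStepSize_eq]
    push_cast
    have : (t : ℝ) + 1 + 3 = t + 4 := by ring
    rw [this]
    field_simp
  have hlow : 1 - 2 / ((t : ℝ) + 3) ≤ ((t : ℝ) + 3) / (t + 4) *
      (Real.log ((t : ℝ) + 3) ^ ν / Real.log ((t : ℝ) + 4) ^ ν) := by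
    have h1 : 1 - 1 / ((t : ℝ) + 3) ≤ ((t : ℝ) + 3) / (t + 4) := by
      rw [sub_le_iff_le_add, div_add_div _ _ (by linarith) (by linarith), le_div_iff₀ (by positivity)]
      nlinarith
    have h2 : (0 : ℝ) ≤ 1 - 1 / ((t : ℝ) + 3) := by
      rw [sub_nonneg, div_le_one (by linarith)]; linarith
    have h3 := mul_le_mul h1 (h1.trans (hratio.trans hpow)) h2 (h2.trans h1)
    refine le_trans ?_ h3
    have : 2 / ((t : ℝ) + 3) = 2 * (1 / ((t : ℝ) + 3)) := by ring
    rw [this]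
    nlinarith [sq_nonneg (1 / ((t : ℝ) + 3))]
  have := mul_le_mul_of_nonneg_left hlow (logStepSize_one_pos (ν := ν) t).le
  rw [← hq] at this
  linarith

/-- `exp (ln^{1-ν} t)` grows more slowly than every power of `t`. -/
theorem exists_exp_logExponent_le (hν0 : 0 < ν) (hν1 : ν < 1) {k : ℝ} (hk : 0 ≤ k) :
    ∃ D : ℝ, 0 < D ∧ ∀ t : ℕ, Real.exp (k * logExponent ν t) ≤ D * ((t : ℝ) + 3) := by
  obtain ⟨k', hk'⟩ : ∃ k', k' = k / (1 - ν) := ⟨_, rfl⟩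
  have hk0 : 0 ≤ k' := hk' ▸ div_nonneg hk (by linarith)
  set D := k' * (k' ^ (1 / ν)) ^ (1 - ν) with hD
  have hx0 : 0 ≤ k' ^ (1 / ν) := Real.rpow_nonneg hk0 _
  have key : ∀ x : ℝ, 0 ≤ x → k' * x ^ (1 - ν) ≤ x + D := by
    intro x hx
    rcases le_total (k' ^ (1 / ν)) x with h | h
    · have h1 : k' ≤ x ^ ν := by
        calc k' = (k' ^ (1 / ν)) ^ ν := by
              rw [← Real.rpow_mul hk0, one_div, inv_mul_cancel₀ hν0.ne', Real.rpow_one]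
          _ ≤ x ^ ν := Real.rpow_le_rpow hx0 h hν0.le
      have h2 : k' * x ^ (1 - ν) ≤ x ^ ν * x ^ (1 - ν) :=
        mul_le_mul_of_nonneg_right h1 (Real.rpow_nonneg hx _)
      rw [← Real.rpow_add_of_nonneg hx hν0.le (by linarith)] at h2
      have h3 : ν + (1 - ν) = 1 := by ring
      rw [h3, Real.rpow_one] at h2
      have : 0 ≤ D := mul_nonneg hk0 (Real.rpow_nonneg hx0 _)
      linarith
    · have : k' * x ^ (1 - ν) ≤ D :=
        mul_le_mul_of_nonneg_left (Real.rpow_le_rpow hx h (by linarith)) hk0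
      linarith
  refine ⟨Real.exp D, Real.exp_pos _, fun t => ?_⟩
  have ht : (0 : ℝ) ≤ t := t.cast_nonneg
  have h := key (Real.log ((t : ℝ) + 1)) (Real.log_nonneg (by linarith))
  have h1 : k * logExponent ν t = k' * Real.log ((t : ℝ) + 1) ^ (1 - ν) := by
    rw [hk', logExponent]; ring
  calc Real.exp (k * logExponent ν t) ≤ Real.exp (Real.log ((t : ℝ) + 1) + D) := by
        rw [h1]; exact Real.exp_le_exp.2 h
    _ = Real.exp D * ((t : ℝ) + 1) := by
        rw [Real.exp_add, Real.exp_log (by linarith), mul_comm]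
    _ ≤ _ := by gcongr; norm_num

theorem log_le_logExponent_pow (hν0 : 0 < ν) (hν1 : ν < 1) (t : ℕ) :
    Real.log ((t : ℝ) + 1) ≤ (1 + logExponent ν t) ^ ⌈1 / (1 - ν)⌉₊ := by
  have hl : 0 ≤ Real.log ((t : ℝ) + 1) := Real.log_nonneg (by simp)
  have hS := logExponent_nonneg hν1 t
  have h1 : Real.log ((t : ℝ) + 1) = ((1 - ν) * logExponent ν t) ^ (1 / (1 - ν)) := by
    unfold logExponent
    rw [mul_div_cancel₀ _ (by linarith : 1 - ν ≠ 0), ← Real.rpow_mul hl,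
      mul_one_div_cancel (by linarith : 1 - ν ≠ 0), Real.rpow_one]
  rw [h1, ← Real.rpow_natCast]
  have h2 : (1 - ν) * logExponent ν t ≤ 1 + logExponent ν t := by nlinarith
  refine (Real.rpow_le_rpow (mul_nonneg (by linarith) hS) h2 (by
    apply div_nonneg <;> linarith)).trans ?_
  exact Real.rpow_le_rpow_of_exponent_le (by linarith) (Nat.le_ceil _)

theorem le_of_contracting_recursion {x a α q : ℕ → ℝ} {b M N : ℝ} {T : ℕ} (ha : ∀ t, 0 ≤ a t)
    (hq : Monotone q) (hq0 : ∀ t, 0 ≤ q t) (hα : ∀ t, 0 ≤ α t) (hbα : ∀ t, T ≤ t → b * α t ≤ 1)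
    (hN : 0 ≤ N) (hMN : 2 * M ≤ b * N)
    (hstep : ∀ t, T ≤ t → (1 - b * α t / 2) * a t ≤ a (t + 1))
    (hrec : ∀ t, T ≤ t → x (t + 1) ≤ (1 - b * α t) * x t + α t * (M * q t * a t))
    (h0 : x T ≤ N * q T * a T) : ∀ t, T ≤ t → x t ≤ N * q t * a t := by
  intro t ht
  induction t, ht using Nat.le_induction with
  | base => exact h0
  | succ t ht ih =>
    have h1 : (1 - b * α t) * x t ≤ (1 - b * α t) * (N * q t * a t) :=
      mul_le_mul_of_nonneg_left ih (by linarith [hbα t ht])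
    have hqa : 0 ≤ α t * (q t * a t) := mul_nonneg (hα t) (mul_nonneg (hq0 t) (ha t))
    have h2 : N * q t * ((1 - b * α t / 2) * a t) ≤ N * q t * a (t + 1) :=
      mul_le_mul_of_nonneg_left (hstep t ht) (mul_nonneg hN (hq0 t))
    have h3 : N * q t * a (t + 1) ≤ N * q (t + 1) * a (t + 1) :=
      mul_le_mul_of_nonneg_right (mul_le_mul_of_nonneg_left (hq t.le_succ) hN) (ha _)
    have h4 := mul_le_mul_of_nonneg_right hMN hqa
    linarith [hrec t ht]

theorem le_exp_of_growth {b S α : ℕ → ℝ} {c k : ℝ} (hc : 0 ≤ c) (hb : ∀ t, 0 ≤ b t)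
    (hS0 : S 0 = 0) (hα : ∀ t, α t ≤ k * (S (t + 1) - S t))
    (hrec : ∀ t, b (t + 1) ≤ (1 + c * α t) * b t) (t : ℕ) :
    b t ≤ b 0 * Real.exp (c * k * S t) := by
  induction t with
  | zero => simp [hS0]
  | succ t ih =>
    have h1 : 1 + c * α t ≤ Real.exp (c * k * (S (t + 1) - S t)) := by
      have := Real.add_one_le_exp (c * k * (S (t + 1) - S t))
      have h2 := mul_le_mul_of_nonneg_left (hα t) hc
      linarith
    calc b (t + 1) ≤ (1 + c * α t) * b t := hrec t
      _ ≤ Real.exp (c * k * (S (t + 1) - S t)) * (b 0 * Real.exp (c * k * S t)) :=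
          mul_le_mul h1 ih (hb t) (Real.exp_pos _).le
      _ = b 0 * Real.exp (c * k * S (t + 1)) := by
          rw [mul_left_comm, ← Real.exp_add]
          congr 2
          ring

end StepSizes

section Pathwise

variable {E 𝒴 : Type*} [NormedAddCommGroup E] [NormedSpace ℝ E] [MeasurableSpace 𝒴]

/-- The average, with step sizes `α`, of the martingale differences
`ψ (w_t, y_{t+1}) - ∫ ψ (w_t, ·) ∂K(y_t)`. -/
noncomputable def martingaleAverage (K : Kernel 𝒴 𝒴) (ψ : E → 𝒴 → E) (α : ℕ → ℝ) (w : ℕ → E)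
    (y : ℕ → 𝒴) : ℕ → E
  | 0 => 0
  | t + 1 => (1 - α t) • martingaleAverage K ψ α w y t +
      α t • (ψ (w t) (y (t + 1)) - ∫ z, ψ (w t) z ∂(K (y t)))

theorem logStepSize_nonneg {ν c : ℝ} (hc : 0 ≤ c) (t : ℕ) : 0 ≤ logStepSize c ν t := by
  rw [logStepSize_eq_mul]
  exact mul_nonneg hc (logStepSize_one_pos t).le

theorem norm_saIterate_succ_sub_le {E 𝒴 : Type*} [NormedAddCommGroup E] [NormedSpace ℝ E]
    {H : E → 𝒴 → E} {G : ℝ}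
    (hG : ∀ w y, ‖H w y‖ ≤ G * (1 + ‖w‖)) {α : ℕ → ℝ} (hα : ∀ t, 0 ≤ α t) (w₀ : E) (y : ℕ → 𝒴)
    (t : ℕ) : ‖saIterate H α w₀ y (t + 1) - saIterate H α w₀ y t‖ ≤
      α t * ((G + 1) * (1 + ‖saIterate H α w₀ y t‖)) := by
  rw [saIterate, add_sub_cancel_left, norm_smul, Real.norm_eq_abs, abs_of_nonneg (hα t)]
  refine mul_le_mul_of_nonneg_left ?_ (hα t)
  refine (norm_sub_le _ _).trans ?_
  linarith [hG (saIterate H α w₀ y t) (y (t + 1))]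

theorem one_add_norm_saIterate_le {E 𝒴 : Type*} [NormedAddCommGroup E] [NormedSpace ℝ E]
    {H : E → 𝒴 → E} {G : ℝ} (hG0 : 0 ≤ G)
    (hG : ∀ w y, ‖H w y‖ ≤ G * (1 + ‖w‖)) {ν c : ℝ} (hν0 : 0 < ν) (hν1 : ν < 1) (hc : 0 ≤ c)
    {w₀ : E} {R : ℝ} (hR : ‖w₀‖ ≤ R) (y : ℕ → 𝒴) (t : ℕ) :
    1 + ‖saIterate H (logStepSize c ν) w₀ y t‖ ≤
      (1 + R) * Real.exp ((G + 1) * c * logExponent ν t) := by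
  have h := le_exp_of_growth (b := fun t => 1 + ‖saIterate H (logStepSize c ν) w₀ y t‖)
    (S := logExponent ν) (α := logStepSize c ν) (c := G + 1) (k := c) (by linarith)
    (fun t => by positivity) (logExponent_zero hν1) (fun t => by
      rw [logStepSize_eq_mul]
      exact mul_le_mul_of_nonneg_left (logStepSize_one_le_sub hν0 hν1 t) hc)
    (fun t => by
      have h1 := norm_saIterate_succ_sub_le hG (logStepSize_nonneg (ν := ν) hc) w₀ y t
      have h2 := norm_le_norm_add_norm_sub' (saIterate H (logStepSize c ν) w₀ y (t + 1))
        (saIterate H (logStepSize c ν) w₀ y t)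
      linarith) t
  refine h.trans (mul_le_mul_of_nonneg_right ?_ (Real.exp_pos _).le)
  simp only [saIterate]
  linarith

/-- Step sizes are eventually at most one, and large compared to the increments of the
logarithmic exponent. -/
theorem logStepSize_eventually {ν c : ℝ} (hν0 : 0 < ν) (hν1 : ν < 1) (hc : 8 ≤ c) {t : ℕ}
    (ht : ⌈c⌉₊ ≤ t) : logStepSize c ν t ≤ 1 ∧
      c * (logExponent ν (t + 1) - logExponent ν t) ≤ 4 * logStepSize c ν t := by
  have hct : c ≤ t := (Nat.le_ceil c).trans (by exact_mod_cast ht)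
  have ht1 : 1 ≤ t := by
    have : (1 : ℝ) ≤ t := by linarith
    exact_mod_cast this
  rw [logStepSize_eq_mul]
  constructor
  · calc c * logStepSize 1 ν t ≤ c * (1 / ((t : ℝ) + 3)) :=
          mul_le_mul_of_nonneg_left (logStepSize_one_le hν0 t) (by linarith)
      _ ≤ 1 := by
          rw [mul_one_div, div_le_one (by linarith)]
          linarith
  · have := mul_le_mul_of_nonneg_left (sub_le_logStepSize_one hν0 hν1 ht1) (by linarith : 0 ≤ c)
    linarith

theorem logStepSize_le {ν c : ℝ} (hν0 : 0 < ν) (hc : 0 ≤ c) (t : ℕ) :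
    logStepSize c ν t ≤ c / ((t : ℝ) + 3) := by
  rw [logStepSize_eq_mul, div_eq_mul_one_div]
  exact mul_le_mul_of_nonneg_left (logStepSize_one_le hν0 t) hc

theorem exists_variance_bound {ν c b k : ℝ} (hν0 : 0 < ν) (hν1 : ν < 1) (hc : 8 ≤ c)
    (hk : 0 ≤ k) {V : ℕ → ℝ}
    (hV0 : V 0 = 0) (hV : ∀ t, V (t + 1) = (1 - logStepSize c ν t) ^ 2 * V t +
      logStepSize c ν t ^ 2 * (b * Real.exp (k * logExponent ν t)) ^ 2) :
    ∃ W : ℝ, 0 < W ∧ ∀ t, V t ≤ W * Real.exp (-logExponent ν t) := by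
  have hα := logStepSize_nonneg (ν := ν) (by linarith : 0 ≤ c)
  obtain ⟨D, hD, hDb⟩ := exists_exp_logExponent_le hν0 hν1 (by linarith : 0 ≤ 2 * k + 1)
  set T := ⌈c⌉₊ with hT
  have hVnn : ∀ t, 0 ≤ V t := fun t => by
    cases t with
    | zero => exact hV0.ge
    | succ t =>
      induction t with
      | zero => rw [hV, hV0]; positivity
      | succ t ih => rw [hV]; positivity
  set M := c * b ^ 2 * D with hM
  have hM0 : 0 ≤ M := by positivity
  obtain ⟨N, hN⟩ : ∃ r, r = 2 * M + 1 + ∑ t ∈ Finset.range (T + 1), V t * Real.exp (logExponent ν t) := ⟨_, rfl⟩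
  have hsum : 0 ≤ ∑ t ∈ Finset.range (T + 1), V t * Real.exp (logExponent ν t) :=
    Finset.sum_nonneg fun t _ => mul_nonneg (hVnn t) (Real.exp_pos _).le
  have hsmall : ∀ t ≤ T, V t ≤ N * Real.exp (-logExponent ν t) := fun t ht => by
    have h1 : V t * Real.exp (logExponent ν t) ≤ N := by
      have := Finset.single_le_sum (f := fun t => V t * Real.exp (logExponent ν t))
        (fun t _ => mul_nonneg (hVnn t) (Real.exp_pos _).le)
        (Finset.mem_range.2 (Nat.lt_succ_of_le ht))
      linarith
    rw [Real.exp_neg, ← div_eq_mul_inv, le_div_iff₀ (Real.exp_pos _)]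
    exact h1
  refine ⟨N, by linarith, fun t => ?_⟩
  rcases le_total t T with ht | ht
  · exact hsmall t ht
  have := le_of_contracting_recursion (x := V) (a := fun t => Real.exp (-logExponent ν t))
    (α := logStepSize c ν) (q := fun _ => 1) (b := 1) (M := M) (N := N) (T := T)
    (fun t => (Real.exp_pos _).le) monotone_const (fun _ => zero_le_one) hα
    (fun t ht => by rw [one_mul]; exact (logStepSize_eventually hν0 hν1 hc ht).1)
    (by linarith) (by linarith)
    (fun t ht => by
      have h1 := (logStepSize_eventually hν0 hν1 hc ht).2
      have h2 : -logExponent ν (t + 1) =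
        -(logExponent ν (t + 1) - logExponent ν t) + -logExponent ν t := by ring
      have h3 := Real.add_one_le_exp (-(logExponent ν (t + 1) - logExponent ν t))
      have h4 : 0 ≤ logExponent ν (t + 1) - logExponent ν t :=
        sub_nonneg.2 (logExponent_monotone hν0 hν1 t.le_succ)
      rw [h2, Real.exp_add]
      refine mul_le_mul_of_nonneg_right ?_ (Real.exp_pos _).le
      nlinarith)
    (fun t ht => by
      have h1 := (logStepSize_eventually hν0 hν1 hc ht).1
      have h2 : (1 - logStepSize c ν t) ^ 2 * V t ≤ (1 - 1 * logStepSize c ν t) * V t := by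
        refine mul_le_mul_of_nonneg_right ?_ (hVnn t)
        nlinarith [hα t]
      have h3 : logStepSize c ν t * (b * Real.exp (k * logExponent ν t)) ^ 2 ≤
          M * 1 * Real.exp (-logExponent ν t) := by
        have ht3 : (0 : ℝ) < (t : ℝ) + 3 := by positivity
        have hexp : Real.exp (k * logExponent ν t) ^ 2 =
            Real.exp ((2 * k + 1) * logExponent ν t) * Real.exp (-logExponent ν t) := by
          rw [← Real.exp_add, ← Real.exp_nat_mul]
          congr 1
          push_cast
          ring
        rw [mul_pow, hexp]
        calc _ ≤ c / ((t : ℝ) + 3) * (b ^ 2 * (D * ((t : ℝ) + 3) *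
                Real.exp (-logExponent ν t))) := by
              gcongr
              · exact logStepSize_le hν0 (by linarith) t
              · exact hDb t
          _ = _ := by rw [hM]; field_simp
      have h4 := mul_le_mul_of_nonneg_left h3 (hα t)
      rw [hV]
      linarith)
    (by simpa using hsmall T le_rfl) t ht
  simpa using this

/-- On every path, the iterates inherit the decay of the averaged martingale differences. -/
theorem exists_pathwise_bound {H ψ : E → 𝒴 → E} {h : E → E} {K : Kernel 𝒴 𝒴} [IsMarkovKernel K]
    {ν c κ G A b k : ℝ} (hν0 : 0 < ν) (hν1 : ν < 1) (hκ0 : 0 ≤ κ) (hκ1 : κ < 1)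
    (hc : 8 / (1 - κ) ≤ c) (hG0 : 0 ≤ G) (hA0 : 0 ≤ A) (hb0 : 0 ≤ b) (hk0 : 0 ≤ k)
    (hG : ∀ w y, ‖H w y‖ ≤ G * (1 + ‖w‖))
    (hcontr : ∀ w w', ‖h w - h w'‖ ≤ κ * ‖w - w'‖) {wstar : E} (hfix : h wstar = wstar)
    (hpoisson : ∀ w y, H w y - h w = ψ w y - ∫ z, ψ w z ∂(K y))
    (hΦ : ∀ w y, ‖∫ z, ψ w z ∂(K y)‖ ≤ A * (1 + ‖w‖))
    (hΦlip : ∀ w w' y, ‖∫ z, ψ w z ∂(K y) - ∫ z, ψ w' z ∂(K y)‖ ≤ A * ‖w - w'‖) :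
    ∃ M : ℝ, 0 < M ∧ ∀ (w₀ : E) (y : ℕ → 𝒴) (w : ℕ → E) (q : ℕ → ℝ),
      w = saIterate H (logStepSize c ν) w₀ y →
      (∀ t, 1 + ‖w t‖ ≤ b * Real.exp (k * logExponent ν t)) →
      Monotone q → (∀ t, 1 ≤ q t) →
      (∀ t, ‖martingaleAverage K ψ (logStepSize c ν) w y t‖ ≤
        q t * Real.exp (-logExponent ν t / 2)) →
      ∀ t, ‖w t - wstar‖ ≤ M * q t * Real.exp (-logExponent ν t / 2) := by
  have hκ' : 0 < 1 - κ := by linarith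
  have hc8 : 8 ≤ c := by
    refine le_trans ?_ hc
    rw [le_div_iff₀ hκ']
    linarith
  have hcκ : 8 ≤ (1 - κ) * c := by
    rw [div_le_iff₀ hκ'] at hc
    linarith
  have hc0 : 0 ≤ c := by linarith
  have hα := logStepSize_nonneg (ν := ν) hc0
  obtain ⟨D, hD, hDb⟩ := exists_exp_logExponent_le hν0 hν1 (by linarith : 0 ≤ k + 1 / 2)
  set T := ⌈c⌉₊ with hT
  set a : ℕ → ℝ := fun t => Real.exp (-logExponent ν t / 2) with ha
  have ha0 : ∀ t, 0 < a t := fun t => Real.exp_pos _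
  obtain ⟨E₀, hE₀⟩ : ∃ r, r = A * (2 * c + (G + 1) * c + 2 * (G + 2)) := ⟨_, rfl⟩
  have hE₀0 : 0 ≤ E₀ := by rw [hE₀]; positivity
  -- the growth of the iterates is absorbed by one factor `1 / (t + 3)`
  have hsub : ∀ t : ℕ, b * Real.exp (k * logExponent ν t) / ((t : ℝ) + 3) ≤ b * D * a t := by
    intro t
    have ht3 : (0 : ℝ) < (t : ℝ) + 3 := by positivity
    have hexp : Real.exp (k * logExponent ν t) =
        Real.exp ((k + 1 / 2) * logExponent ν t) * a t := by
      rw [ha, ← Real.exp_add]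
      congr 1
      ring
    rw [hexp, div_le_iff₀ ht3]
    have := mul_le_mul_of_nonneg_left (mul_le_mul_of_nonneg_right (hDb t) (ha0 t).le) hb0
    linarith
  obtain ⟨M₁, hM₁⟩ : ∃ r, r = 1 + E₀ * (b * D) := ⟨_, rfl⟩
  have hM₁0 : 0 ≤ M₁ := by rw [hM₁]; positivity
  obtain ⟨B, hB⟩ : ∃ r, r = b * Real.exp (k * logExponent ν T) + ‖wstar‖ := ⟨_, rfl⟩
  have hB0 : 0 ≤ B := by rw [hB]; positivity
  obtain ⟨N, hN⟩ : ∃ r, r = 2 * M₁ / (1 - κ) + (B / a T + 1 + c * A * B / a T) := ⟨_, rfl⟩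
  have haT := ha0 T
  have hN0 : 0 ≤ N := by rw [hN]; positivity
  have hNM : 2 * M₁ ≤ (1 - κ) * N := by
    have h1 : (1 - κ) * (2 * M₁ / (1 - κ)) = 2 * M₁ := by field_simp
    have h2 : 0 ≤ (1 - κ) * (B / a T + 1 + c * A * B / a T) := by positivity
    rw [hN, mul_add, h1]
    linarith
  refine ⟨N + 1 + c * A * b * D + B / a T, by positivity, fun w₀ y w q hw hwb hqm hq1 hm t => ?_⟩
  have hanti : ∀ {s t : ℕ}, s ≤ t → a t ≤ a s := fun {s t} hst => by
    refine Real.exp_le_exp.2 ?_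
    have := logExponent_monotone hν0 hν1 hst
    linarith
  have hwT : ∀ t ≤ T, 1 + ‖w t‖ ≤ b * Real.exp (k * logExponent ν T) := fun t ht => by
    refine (hwb t).trans ?_
    gcongr
    exact logExponent_monotone hν0 hν1 ht
  set Φ : ℕ → E := fun t => ∫ z, ψ (w t) z ∂(K (y t)) with hΦdef
  set m := martingaleAverage K ψ (logStepSize c ν) w y with hmdef
  set z : ℕ → E := fun t => w t - m t + logStepSize c ν t • Φ t - wstar with hz
  have hΦα : ∀ t, ‖logStepSize c ν t • Φ t‖ ≤ c / ((t : ℝ) + 3) * (A * (1 + ‖w t‖)) := fun t => by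
    rw [norm_smul, Real.norm_eq_abs, abs_of_nonneg (hα t)]
    exact mul_le_mul (logStepSize_le hν0 hc0 t) (hΦ _ _) (norm_nonneg _) (by positivity)
  have hwz : ∀ t, ‖w t - wstar‖ ≤ ‖z t‖ + ‖m t‖ + ‖logStepSize c ν t • Φ t‖ := fun t => by
    have : w t - wstar = z t + m t - logStepSize c ν t • Φ t := by simp only [hz]; abel
    rw [this]
    exact (norm_sub_le _ _).trans (by gcongr; exact norm_add_le _ _)
  have hΦa : ∀ t, ‖logStepSize c ν t • Φ t‖ ≤ c * A * b * D * a t := fun t => by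
    refine (hΦα t).trans ?_
    have h1 : (1 + ‖w t‖) / ((t : ℝ) + 3) ≤ b * D * a t :=
      (div_le_div_of_nonneg_right (hwb t) (by positivity)).trans (hsub t)
    calc _ = c * A * ((1 + ‖w t‖) / ((t : ℝ) + 3)) := by ring
      _ ≤ c * A * (b * D * a t) := by gcongr
      _ = _ := by ring
  have hqa : ∀ t, a t ≤ q t * a t := fun t => le_mul_of_one_le_left (ha0 t).le (hq1 t)
  rcases le_total t T with ht | ht
  · have h1 : ‖w t - wstar‖ ≤ B := by
      refine (norm_sub_le _ _).trans ?_
      linarith [hwT t ht]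
    have h2 : B ≤ B / a T * (q t * a t) := by
      have : a T ≤ q t * a t := (hanti ht).trans (hqa t)
      calc B = B / a T * a T := by field_simp
        _ ≤ _ := by gcongr
    have h3 : 0 ≤ q t * a t := (ha0 t).le.trans (hqa t)
    have h4 : 0 ≤ (N + 1 + c * A * b * D) * (q t * a t) := by positivity
    linarith
  have hrec : ∀ t, T ≤ t → ‖z (t + 1)‖ ≤ (1 - (1 - κ) * logStepSize c ν t) * ‖z t‖ +
      logStepSize c ν t * (M₁ * q t * a t) := by
    intro t ht
    obtain ⟨α, hαdef⟩ : ∃ α, α = logStepSize c ν t := ⟨_, rfl⟩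
    obtain ⟨α', hα'def⟩ : ∃ α', α' = logStepSize c ν (t + 1) := ⟨_, rfl⟩
    have hα0 : 0 ≤ α := hαdef ▸ hα t
    have hα1 : α ≤ 1 := hαdef ▸ (logStepSize_eventually hν0 hν1 hc8 ht).1
    have hαt : α ≤ c / ((t : ℝ) + 3) := hαdef ▸ logStepSize_le hν0 hc0 t
    have hdiff0 : 0 ≤ α - α' := by
      rw [hαdef, hα'def, logStepSize_eq_mul, logStepSize_eq_mul c (t + 1), ← mul_sub]
      exact mul_nonneg hc0 (sub_nonneg.2 (logStepSize_one_antitone_step hν0 t))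
    have hdiff : α - α' ≤ 2 / ((t : ℝ) + 3) * α := by
      rw [hαdef, hα'def, logStepSize_eq_mul, logStepSize_eq_mul c (t + 1), ← mul_sub]
      have := mul_le_mul_of_nonneg_left (logStepSize_one_sub_le hν0 hν1 t) hc0
      linarith
    have hw1 : w (t + 1) = w t + α • (H (w t) (y (t + 1)) - w t) := by
      rw [hw, hαdef]; rfl
    have hm1 : m (t + 1) = (1 - α) • m t + α • (ψ (w t) (y (t + 1)) - Φ t) := by
      rw [hαdef]; rfl
    have hH : H (w t) (y (t + 1)) = h (w t) + (ψ (w t) (y (t + 1)) -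
        ∫ z, ψ (w t) z ∂(K (y (t + 1)))) := by
      rw [← hpoisson]; abel
    have hzstep : z (t + 1) = (1 - α) • z t + α • (h (w t) - wstar) + α • (α • Φ t) +
        α • (Φ (t + 1) - ∫ z, ψ (w t) z ∂(K (y (t + 1)))) - (α - α') • Φ (t + 1) := by
      simp only [hz]
      rw [hw1, hm1, hH, ← hαdef, ← hα'def]
      module
    have hβ1 : ‖w (t + 1) - w t‖ ≤ α * ((G + 1) * (1 + ‖w t‖)) := by
      rw [hαdef, hw]
      exact norm_saIterate_succ_sub_le hG hα w₀ y t
    have hβ2 : 1 + ‖w (t + 1)‖ ≤ (G + 2) * (1 + ‖w t‖) := by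
      have h1 := norm_le_norm_add_norm_sub' (w (t + 1)) (w t)
      have h2 : α * ((G + 1) * (1 + ‖w t‖)) ≤ 1 * ((G + 1) * (1 + ‖w t‖)) := by gcongr
      linarith
    have hn1 : ‖h (w t) - wstar‖ ≤ κ * (‖z t‖ + ‖m t‖ + ‖α • Φ t‖) := by
      calc ‖h (w t) - wstar‖ = ‖h (w t) - h wstar‖ := by rw [hfix]
        _ ≤ κ * ‖w t - wstar‖ := hcontr _ _
        _ ≤ _ := by
          gcongr
          rw [hαdef]
          exact hwz t
    have hn2 : ‖Φ (t + 1) - ∫ z, ψ (w t) z ∂(K (y (t + 1)))‖ ≤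
        A * (α * ((G + 1) * (1 + ‖w t‖))) :=
      (hΦlip _ _ _).trans (mul_le_mul_of_nonneg_left hβ1 hA0)
    have hn3 : ‖Φ (t + 1)‖ ≤ A * ((G + 2) * (1 + ‖w t‖)) :=
      (hΦ _ _).trans (mul_le_mul_of_nonneg_left hβ2 hA0)
    have hn4 : ‖α • Φ t‖ ≤ c / ((t : ℝ) + 3) * (A * (1 + ‖w t‖)) := hαdef ▸ hΦα t
    have hnorm : ‖z (t + 1)‖ ≤ (1 - α) * ‖z t‖ + α * ‖h (w t) - wstar‖ + α * ‖α • Φ t‖ +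
        α * ‖Φ (t + 1) - ∫ z, ψ (w t) z ∂(K (y (t + 1)))‖ + (α - α') * ‖Φ (t + 1)‖ := by
      rw [hzstep]
      refine (norm_sub_le _ _).trans (add_le_add ((norm_add_le _ _).trans (add_le_add
        ((norm_add_le _ _).trans (add_le_add ((norm_add_le _ _).trans (add_le_add ?_ ?_)) ?_)) ?_))
        ?_)
      · rw [norm_smul, Real.norm_eq_abs, abs_of_nonneg (by linarith)]
      all_goals rw [norm_smul _ (_ : E), Real.norm_eq_abs, abs_of_nonneg (by assumption)]
    have hmq : ‖m t‖ ≤ q t * a t := hm t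
    have hcore : (1 + ‖w t‖) / ((t : ℝ) + 3) ≤ b * D * (q t * a t) :=
      (div_le_div_of_nonneg_right (hwb t) (by positivity)).trans ((hsub t).trans (by
        gcongr; exact hqa t))
    obtain ⟨β, hβ⟩ : ∃ β, β = (1 + ‖w t‖) / ((t : ℝ) + 3) := ⟨_, rfl⟩
    have hβ0 : 0 ≤ β := by rw [hβ]; positivity
    have ht3 : (0 : ℝ) < (t : ℝ) + 3 := by positivity
    have e1 : ‖α • Φ t‖ ≤ A * c * β := hn4.trans_eq (by rw [hβ]; ring)
    have e2 : ‖Φ (t + 1) - ∫ z, ψ (w t) z ∂(K (y (t + 1)))‖ ≤ A * ((G + 1) * c) * β := by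
      refine hn2.trans ?_
      calc A * (α * ((G + 1) * (1 + ‖w t‖)))
          ≤ A * (c / ((t : ℝ) + 3) * ((G + 1) * (1 + ‖w t‖))) := by gcongr
        _ = _ := by rw [hβ]; ring
    have e3 : (α - α') * ‖Φ (t + 1)‖ ≤ α * (A * (2 * (G + 2)) * β) := by
      calc (α - α') * ‖Φ (t + 1)‖ ≤ (2 / ((t : ℝ) + 3) * α) * (A * ((G + 2) * (1 + ‖w t‖))) :=
            mul_le_mul hdiff hn3 (norm_nonneg _) (by positivity)
        _ = _ := by rw [hβ]; ring
    have e4 : ‖h (w t) - wstar‖ ≤ κ * ‖z t‖ + (q t * a t + A * c * β) := by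
      refine hn1.trans ?_
      have : κ * (‖m t‖ + ‖α • Φ t‖) ≤ 1 * (q t * a t + A * c * β) := by gcongr
      linarith
    have e5 : E₀ * β ≤ E₀ * (b * D * (q t * a t)) := by rw [hβ]; gcongr
    rw [← hαdef]
    have e6 : q t * a t + A * c * β + A * c * β + A * ((G + 1) * c) * β +
        A * (2 * (G + 2)) * β ≤ M₁ * q t * a t := by
      rw [hM₁]
      have : E₀ * β = A * c * β + A * c * β + A * ((G + 1) * c) * β +
        A * (2 * (G + 2)) * β := by rw [hE₀]; ring
      linarith
    have f1 := mul_le_mul_of_nonneg_left e1 hα0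
    have f2 := mul_le_mul_of_nonneg_left e2 hα0
    have f4 := mul_le_mul_of_nonneg_left e4 hα0
    have f6 := mul_le_mul_of_nonneg_left e6 hα0
    linarith
  have hzT : ‖z T‖ ≤ N * q T * a T := by
    have h1 : ‖z T‖ ≤ ‖w T - wstar‖ + ‖m T‖ + ‖logStepSize c ν T • Φ T‖ := by
      have : z T = w T - wstar - m T + logStepSize c ν T • Φ T := by simp only [hz]; abel
      rw [this]
      exact (norm_add_le _ _).trans (by gcongr; exact norm_sub_le _ _)
    have h2 : ‖w T - wstar‖ ≤ B := by
      refine (norm_sub_le _ _).trans ?_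
      linarith [hwT T le_rfl]
    have h3 : ‖logStepSize c ν T • Φ T‖ ≤ c * A * B := by
      have h4 : c / ((T : ℝ) + 3) ≤ c := div_le_self hc0 (by
        have : (0 : ℝ) ≤ T := T.cast_nonneg
        linarith)
      have h5 : 1 + ‖w T‖ ≤ B := by linarith [hwT T le_rfl, norm_nonneg wstar]
      calc _ ≤ c / ((T : ℝ) + 3) * (A * (1 + ‖w T‖)) := hΦα T
        _ ≤ c * (A * B) := by gcongr
        _ = _ := by ring
    have h6 : B + c * A * B ≤ (B / a T + c * A * B / a T) * (q T * a T) := by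
      calc B + c * A * B = (B / a T + c * A * B / a T) * a T := by field_simp
        _ ≤ _ := by gcongr; exact hqa T
    have h7 : 0 ≤ 2 * M₁ / (1 - κ) * (q T * a T) :=
      mul_nonneg (by positivity) ((ha0 T).le.trans (hqa T))
    have h8 := hm T
    rw [hN]
    linarith
  have hzt := le_of_contracting_recursion (x := fun t => ‖z t‖) (a := a) (α := logStepSize c ν)
    (q := q) (b := 1 - κ) (M := M₁) (N := N) (T := T) (fun t => (ha0 t).le) hqm
    (fun t => zero_le_one.trans (hq1 t)) hα
    (fun t ht => by
      have := (logStepSize_eventually hν0 hν1 hc8 ht).1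
      nlinarith [hα t])
    hN0 hNM
    (fun t ht => by
      have h1 := (logStepSize_eventually hν0 hν1 hc8 ht).2
      have h2 : -logExponent ν (t + 1) / 2 =
        -((logExponent ν (t + 1) - logExponent ν t) / 2) + -logExponent ν t / 2 := by ring
      have h3 := Real.add_one_le_exp (-((logExponent ν (t + 1) - logExponent ν t) / 2))
      have h4 : 0 ≤ logExponent ν (t + 1) - logExponent ν t :=
        sub_nonneg.2 (logExponent_monotone hν0 hν1 t.le_succ)
      have h5 : logExponent ν (t + 1) - logExponent ν t ≤ (1 - κ) * logStepSize c ν t := by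
        have h6 := mul_le_mul_of_nonneg_left h1 hκ'.le
        have h7 := mul_le_mul_of_nonneg_right hcκ h4
        have h8 := mul_nonneg hκ'.le (hα t)
        linarith
      simp only [ha]
      rw [h2, Real.exp_add]
      refine mul_le_mul_of_nonneg_right ?_ (Real.exp_pos _).le
      linarith)
    hrec hzT t ht
  have h9 := hwz t
  have h10 := hΦa t
  have h11 := hm t
  have h12 : c * A * b * D * a t ≤ c * A * b * D * (q t * a t) := by gcongr; exact hqa t
  have h13 : 0 ≤ B / a T * (q t * a t) := mul_nonneg (by positivity) ((ha0 t).le.trans (hqa t))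
  change ‖w t - wstar‖ ≤ _ * a t
  linarith

end Pathwise

section MainTheorem

theorem tsum_ofReal_telescoping_le {a : ℝ} (ha : 0 ≤ a) :
    ∑' t : ℕ, ENNReal.ofReal (a / (((t : ℝ) + 1) * ((t : ℝ) + 2))) ≤ ENNReal.ofReal a := by
  refine ENNReal.tsum_le_of_sum_range_le fun N => ?_
  rw [← ENNReal.ofReal_sum_of_nonneg fun t _ => by positivity]
  refine ENNReal.ofReal_le_ofReal ?_
  have h : ∀ N : ℕ, ∑ t ∈ Finset.range N, a / (((t : ℝ) + 1) * ((t : ℝ) + 2)) =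
      a - a / ((N : ℝ) + 1) := fun N => by
    induction N with
    | zero => simp
    | succ N ih =>
      rw [Finset.sum_range_succ, ih]
      push_cast
      field_simp
      ring
  rw [h]
  have : 0 ≤ a / ((N : ℝ) + 1) := by positivity
  linarith

/-- A union bound over finitely many sub-Gaussian processes and all times. -/
theorem measure_iUnion_ge_le {Ω J : Type*} [MeasurableSpace Ω] [Fintype J] {μ : Measure Ω}
    {X : J → ℕ → Ω → ℝ} (hX : ∀ j t, Measurable (X j t)) {V U : ℕ → ℝ} (hVU : ∀ t, V t ≤ U t)
    (hU : ∀ t, 0 < U t)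
    (h : ∀ j t (l : ℝ), ∫⁻ ω, ENNReal.ofReal (Real.exp (l * X j t ω)) ∂μ ≤
      ENNReal.ofReal (Real.exp (l ^ 2 * V t / 2))) {δ : ℝ} (hδ0 : 0 < δ) (hδ1 : δ < 1) :
    μ (⋃ j, ⋃ t : ℕ, {ω | √(2 * U t * Real.log
      (((Fintype.card J : ℝ) + 1) * (((t : ℝ) + 1) * ((t : ℝ) + 2)) / δ)) ≤ X j t ω}) ≤
      ENNReal.ofReal δ := by
  set n : ℝ := (Fintype.card J : ℝ) with hn
  have hn0 : 0 ≤ n := Nat.cast_nonneg _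
  have hone : ∀ j (t : ℕ), μ {ω | √(2 * U t * Real.log
      ((n + 1) * (((t : ℝ) + 1) * ((t : ℝ) + 2)) / δ)) ≤ X j t ω} ≤
      ENNReal.ofReal (δ / (n + 1) / (((t : ℝ) + 1) * ((t : ℝ) + 2))) := fun j t => by
    have ht : (0 : ℝ) ≤ t := t.cast_nonneg
    have harg : 1 ≤ (n + 1) * (((t : ℝ) + 1) * ((t : ℝ) + 2)) / δ := by
      rw [le_div_iff₀ hδ0]
      nlinarith [mul_nonneg ht ht, mul_nonneg hn0 (mul_nonneg ht ht), mul_nonneg hn0 ht]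
    have hlog := Real.log_nonneg harg
    refine (measure_ge_le_of_lintegral_exp_le (hX j t) (hVU t) (hU t) (h j t)
      (Real.sqrt_nonneg _)).trans (ENNReal.ofReal_le_ofReal ?_)
    have hUt := hU t
    rw [Real.sq_sqrt (by positivity), mul_div_cancel_left₀ _ (by positivity), ← Real.log_inv,
      Real.exp_log (by positivity)]
    apply le_of_eq
    field_simp
  calc _ ≤ ∑ j : J, μ (⋃ t : ℕ, {ω | √(2 * U t * Real.log
      ((n + 1) * (((t : ℝ) + 1) * ((t : ℝ) + 2)) / δ)) ≤ X j t ω}) := measure_iUnion_fintype_le _ _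
    _ ≤ ∑ _j : J, ENNReal.ofReal (δ / (n + 1)) := by
        refine Finset.sum_le_sum fun j _ => ?_
        refine (measure_iUnion_le _).trans ((ENNReal.tsum_le_tsum (hone j)).trans ?_)
        exact tsum_ofReal_telescoping_le (by positivity)
    _ = ENNReal.ofReal (n * (δ / (n + 1))) := by
        rw [Finset.sum_const, Finset.card_univ, nsmul_eq_mul, ENNReal.ofReal_mul hn0, hn,
          ENNReal.ofReal_natCast]
    _ ≤ _ := by
        refine ENNReal.ofReal_le_ofReal ?_
        rw [mul_div_assoc', div_le_iff₀ (by positivity)]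
        nlinarith

variable {E : Type*} [NormedAddCommGroup E] [NormedSpace ℝ E] [FiniteDimensional ℝ E]
  [MeasurableSpace E] [BorelSpace E] {𝒴 : Type*} [m𝒴 : MeasurableSpace 𝒴]

theorem measurable_uncurry_of_lipschitz {f : E → 𝒴 → E} (hf : ∀ w, StronglyMeasurable (f w))
    {A : ℝ} (hlip : ∀ w w' y, ‖f w y - f w' y‖ ≤ A * ‖w - w'‖) :
    Measurable (Function.uncurry f) := by
  have := FiniteDimensional.proper_real E
  refine (stronglyMeasurable_uncurry_of_continuous_of_stronglyMeasurable
    (fun y => ?_) hf).measurable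
  refine (LipschitzWith.of_dist_le_mul (K := A.toNNReal) fun w w' => ?_).continuous
  rw [dist_eq_norm, dist_eq_norm]
  refine (hlip w w' y).trans ?_
  gcongr
  exact Real.le_coe_toNNReal A

theorem measurable_saIterate {Ω : Type*} {mΩ : MeasurableSpace Ω} {ℱ : Filtration ℕ mΩ}
    {H : E → 𝒴 → E} (hH : Measurable (Function.uncurry H)) (α : ℕ → ℝ) {w₀ : Ω → E}
    (hw₀ : Measurable[ℱ 0] w₀) {Y : ℕ → Ω → 𝒴} (hY : ∀ t, Measurable[ℱ t] (Y t)) (t : ℕ) :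
    Measurable[ℱ t] fun ω => saIterate H α (w₀ ω) (fun s => Y s ω) t := by
  have := FiniteDimensional.proper_real E
  induction t with
  | zero => exact hw₀
  | succ t ih =>
    have h1 := ih.mono (ℱ.mono t.le_succ) le_rfl
    have h2 := hH.comp (h1.prodMk (hY (t + 1)))
    exact h1.add ((h2.sub h1).const_smul (α t))

theorem measurable_martingaleAverage {Ω : Type*} {mΩ : MeasurableSpace Ω} {ℱ : Filtration ℕ mΩ}
    {K : Kernel 𝒴 𝒴} {ψ : E → 𝒴 → E} (hψ : Measurable (Function.uncurry ψ))
    (hΦ : Measurable (Function.uncurry fun (w : E) (y : 𝒴) => ∫ z, ψ w z ∂(K y)))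
    (α : ℕ → ℝ) {w : Ω → ℕ → E} {Y : ℕ → Ω → 𝒴} (hw : ∀ t, Measurable[ℱ t] fun ω => w ω t)
    (hY : ∀ t, Measurable[ℱ t] (Y t)) (t : ℕ) :
    Measurable[ℱ t] fun ω => martingaleAverage K ψ α (w ω) (fun s => Y s ω) t := by
  have := FiniteDimensional.proper_real E
  induction t with
  | zero => exact measurable_const
  | succ t ih =>
    have h1 := ih.mono (ℱ.mono t.le_succ) le_rfl
    have hw' := (hw t).mono (ℱ.mono t.le_succ) le_rfl
    have h2 := hψ.comp (hw'.prodMk (hY (t + 1)))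
    have h3 := hΦ.comp (hw'.prodMk ((hY t).mono (ℱ.mono t.le_succ) le_rfl))
    exact (h1.const_smul (1 - α t)).add ((h2.sub h3).const_smul (α t))

/-- Linear functionals of the averaged martingale differences are sub-Gaussian. -/
theorem IsMarkovChain.lintegral_exp_martingaleAverage_le {Ω : Type*} [mΩ : MeasurableSpace Ω]
    {μ : Measure Ω} [IsProbabilityMeasure μ] {ℱ : Filtration ℕ mΩ} {K : Kernel 𝒴 𝒴}
    [IsMarkovKernel K] {Y : ℕ → Ω → 𝒴} (hY : IsMarkovChain μ ℱ K Y) {ψ : E → 𝒴 → E}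
    (hψm : ∀ w, StronglyMeasurable (ψ w)) (hψ : Measurable (Function.uncurry ψ))
    (hΦ : Measurable (Function.uncurry fun (w : E) (y : 𝒴) => ∫ z, ψ w z ∂(K y)))
    {α : ℕ → ℝ} {w : Ω → ℕ → E} (hw : ∀ t, Measurable[ℱ t] fun ω => w ω t) {c V : ℕ → ℝ}
    (hψb : ∀ w, ∃ B : ℝ, ∀ y, ‖ψ w y‖ ≤ B) {f : E →L[ℝ] ℝ}
    (hc : ∀ t ω y, |f (ψ (w ω t) y)| ≤ c t) (hV0 : V 0 = 0)
    (hV : ∀ t, V (t + 1) = (1 - α t) ^ 2 * V t + α t ^ 2 * c t ^ 2) (t : ℕ) (l : ℝ) :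
    ∫⁻ ω, ENNReal.ofReal (Real.exp
      (l * f (martingaleAverage K ψ α (w ω) (fun s => Y s ω) t))) ∂μ ≤
      ENNReal.ofReal (Real.exp (l ^ 2 * V t / 2)) := by
  have := FiniteDimensional.complete ℝ E
  refine hY.lintegral_exp_le (m := fun t ω =>
      f (martingaleAverage K ψ α (w ω) (fun s => Y s ω) t))
    (g := fun t ω y => f (ψ (w ω t) y)) (p := fun t => 1 - α t) (q := α) (c := c) (V := V)
    (fun t => f.continuous.measurable.comp
      (measurable_martingaleAverage hψ hΦ α hw hY.adapted t))
    (fun t => ?_) hc (fun ω => by simp [martingaleAverage]) (fun t ω => ?_) hV0 hV t l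
  · have h1 : Measurable[(ℱ t).prod m𝒴] fun x : Ω × 𝒴 => (w x.1 t, x.2) :=
      ((hw t).comp (@measurable_fst Ω 𝒴 (ℱ t) m𝒴)).prodMk (@measurable_snd Ω 𝒴 (ℱ t) m𝒴)
    exact f.continuous.measurable.comp (hψ.comp h1)
  · obtain ⟨B, hB⟩ := hψb (w ω t)
    have hint : Integrable (ψ (w ω t)) (K (Y t ω)) := integrable_of_bound (hψm _) hB
    rw [f.integral_comp_comm hint, martingaleAverage]
    simp only [map_add, map_smul, map_sub, smul_eq_mul]

theorem log_union_bound_le {ν : ℝ} (hν0 : 0 < ν) (hν1 : ν < 1) {n : ℝ} (hn : 0 ≤ n) {δ : ℝ}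
    (hδ0 : 0 < δ) (hδ1 : δ < 1) (t : ℕ) :
    1 + Real.log ((n + 1) * (((t : ℝ) + 1) * ((t : ℝ) + 2)) / δ) ≤
      3 * (Real.log (1 / δ) + (Real.log (n + 1) + 4) + logExponent ν t) ^ ⌈1 / (1 - ν)⌉₊ := by
  have ht : (0 : ℝ) ≤ t := t.cast_nonneg
  have hS := logExponent_nonneg hν1 t
  have hln : 0 ≤ Real.log (n + 1) := Real.log_nonneg (by linarith)
  have hld : 0 ≤ Real.log (1 / δ) := Real.log_nonneg (by
    rw [le_div_iff₀ hδ0]; linarith)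
  have h2 : Real.log ((t : ℝ) + 2) ≤ Real.log ((t : ℝ) + 1) + 1 := by
    have := Real.add_one_le_exp (1 : ℝ)
    have h := Real.log_le_log (by linarith : 0 < (t : ℝ) + 2)
      (by nlinarith : (t : ℝ) + 2 ≤ (t + 1) * Real.exp 1)
    rwa [Real.log_mul (by linarith) (Real.exp_pos _).ne', Real.log_exp] at h
  have hsplit : Real.log ((n + 1) * (((t : ℝ) + 1) * ((t : ℝ) + 2)) / δ) =
      Real.log (1 / δ) + Real.log (n + 1) + Real.log ((t : ℝ) + 1) + Real.log ((t : ℝ) + 2) := by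
    rw [div_eq_mul_one_div, Real.log_mul (by positivity) (by positivity),
      Real.log_mul (by positivity) (by positivity), Real.log_mul (by positivity) (by positivity)]
    ring
  have hlog := log_le_logExponent_pow hν0 hν1 t
  have hN : ⌈1 / (1 - ν)⌉₊ ≠ 0 := by
    have : 0 < 1 / (1 - ν) := one_div_pos.2 (by linarith)
    exact (Nat.ceil_pos.2 this).ne'
  set Z := Real.log (1 / δ) + (Real.log (n + 1) + 4) + logExponent ν t with hZ
  have hp1 : (1 + logExponent ν t) ^ ⌈1 / (1 - ν)⌉₊ ≤ Z ^ ⌈1 / (1 - ν)⌉₊ :=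
    pow_le_pow_left₀ (by linarith) (by linarith) _
  have hp2 : Z ≤ Z ^ ⌈1 / (1 - ν)⌉₊ := le_self_pow₀ (by linarith) hN
  rw [hsplit]
  linarith

end MainTheorem

theorem theorem2
    {E : Type*} [NormedAddCommGroup E] [NormedSpace ℝ E] [FiniteDimensional ℝ E]
    [MeasurableSpace E] [BorelSpace E]
    {𝒴 : Type*} [MeasurableSpace 𝒴]
    (K : Kernel 𝒴 𝒴) [IsMarkovKernel K] (d : Measure 𝒴) [IsProbabilityMeasure d]
    (hmix : GeometricallyMixing K d)
    (H : E → 𝒴 → E) (hmeas : ∀ w, Measurable (H w))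
    (hcontr : ∃ κ : ℝ, 0 ≤ κ ∧ κ < 1 ∧
      ∀ w w' : E, ‖meanOperator H d w - meanOperator H d w'‖ ≤ κ * ‖w - w'‖)
    (hlip : ∃ L : ℝ, ∀ (w w' : E) (y : 𝒴), ‖H w y - H w' y‖ ≤ L * ‖w - w'‖)
    (hbdd : BddAbove (Set.range fun y => ‖H 0 y‖)) :
    ∃ wstar : E, (∀ w : E, meanOperator H d w = w ↔ w = wstar) ∧
      ∀ ν : ℝ, 0 < ν → ν < 1 →
        ∃ Cbar : ℝ, 0 < Cbar ∧
          ∀ Cα : ℝ, Cbar ≤ Cα → ∀ R : ℝ,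
            ∃ (C C' : ℝ) (C'' : ℕ), 0 < C ∧ 0 < C' ∧
              ∀ (Ω : Type*) [MeasurableSpace Ω] (μ : Measure Ω) [IsProbabilityMeasure μ]
                (ℱ : Filtration ℕ ‹MeasurableSpace Ω›) (Y : ℕ → Ω → 𝒴) (w₀ : Ω → E),
                IsMarkovChain μ ℱ K Y →
                Measurable[ℱ 0] w₀ → (∀ᵐ ω ∂μ, ‖w₀ ω‖ ≤ R) →
                ∀ δ : ℝ, 0 < δ → δ < 1 →
                  1 - δ ≤ μ.real {ω | ∀ t : ℕ,
                    ‖saIterate H (logStepSize Cα ν) (w₀ ω) (fun s => Y s ω) t - wstar‖ ^ 2 ≤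
                      C * Real.exp (-logExponent ν t) *
                        (Real.log (1 / δ) + C' + logExponent ν t) ^ C''} := by
  have hproper := FiniteDimensional.proper_real E
  have hcomplete := FiniteDimensional.complete ℝ E
  obtain ⟨κ, hκ0, hκ1, hcontr⟩ := hcontr
  obtain ⟨wstar, hfix⟩ : ∃ w, meanOperator H d w = w := by
    have hcw : ContractingWith ⟨κ, hκ0⟩ (meanOperator H d) := by
      refine ⟨by exact_mod_cast hκ1, LipschitzWith.of_dist_le_mul fun w w' => ?_⟩
      rw [dist_eq_norm, dist_eq_norm]
      exact hcontr w w'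
    exact ⟨_, hcw.fixedPoint_isFixedPt⟩
  refine ⟨wstar, fun w => ⟨fun hw => ?_, fun hw => hw ▸ hfix⟩, fun ν hν0 hν1 => ?_⟩
  · have h := hcontr w wstar
    rw [hw, hfix] at h
    have h0 : ‖w - wstar‖ = 0 := by nlinarith [norm_nonneg (w - wstar)]
    exact sub_eq_zero.1 (norm_eq_zero.1 h0)
  obtain ⟨L, hL0, hL⟩ : ∃ L : ℝ, 0 ≤ L ∧
      ∀ (w w' : E) (y : 𝒴), ‖H w y - H w' y‖ ≤ L * ‖w - w'‖ := by
    obtain ⟨L, hL⟩ := hlip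
    exact ⟨max L 0, le_max_right _ _, fun w w' y => (hL w w' y).trans
      (mul_le_mul_of_nonneg_right (le_max_left _ _) (norm_nonneg _))⟩
  obtain ⟨G₀, hG₀0, hG₀⟩ : ∃ G : ℝ, 0 ≤ G ∧ ∀ y, ‖H 0 y‖ ≤ G := by
    obtain ⟨G, hG⟩ := hbdd
    exact ⟨max G 0, le_max_right _ _, fun y =>
      (hG (Set.mem_range_self y)).trans (le_max_left _ _)⟩
  have hHm : ∀ w, StronglyMeasurable (H w) := fun w => (hmeas w).stronglyMeasurable
  have hG : ∀ w y, ‖H w y‖ ≤ (G₀ + L) * (1 + ‖w‖) := fun w y => by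
    have h1 := hL w 0 y
    have h2 := norm_le_norm_add_norm_sub' (H w y) (H 0 y)
    rw [sub_zero] at h1
    nlinarith [hG₀ y, mul_nonneg hG₀0 (norm_nonneg w)]
  obtain ⟨ψ, A, hA0, hψm, hψlip, hψb, hpoisson⟩ :=
    exists_poisson_family hmix hHm hL0 hL hG₀ hG₀0
  have hψint : ∀ w y, Integrable (ψ w) (K y) := fun w y => integrable_of_bound (hψm w) (hψb w)
  have hΦb : ∀ w y, ‖∫ z, ψ w z ∂(K y)‖ ≤ A * (1 + ‖w‖) := fun w y =>
    (norm_integral_le_of_norm_le_const (Filter.Eventually.of_forall (hψb w))).trans_eq (by simp)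
  have hΦlip : ∀ w w' y, ‖∫ z, ψ w z ∂(K y) - ∫ z, ψ w' z ∂(K y)‖ ≤ A * ‖w - w'‖ :=
    fun w w' y => by
      rw [← integral_sub (hψint w y) (hψint w' y)]
      exact (norm_integral_le_of_norm_le_const (Filter.Eventually.of_forall
        (hψlip w w'))).trans_eq (by simp)
  have hHu := measurable_uncurry_of_lipschitz hHm hL
  have hψu := measurable_uncurry_of_lipschitz hψm hψlip
  have hΦu := measurable_uncurry_of_lipschitz
    (f := fun (w : E) (y : 𝒴) => ∫ z, ψ w z ∂(K y)) (fun w => (hψm w).integral_kernel) hΦlip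
  have hκ' : 0 < 1 - κ := by linarith
  refine ⟨8 / (1 - κ), by positivity, fun c hc R => ?_⟩
  have hc8 : 8 ≤ c := by
    refine le_trans ?_ hc
    rw [le_div_iff₀ hκ']
    linarith
  obtain ⟨R', hR'0, hRR'⟩ : ∃ R' : ℝ, 0 ≤ R' ∧ R ≤ R' :=
    ⟨max R 0, le_max_right _ _, le_max_left _ _⟩
  obtain ⟨b, hb⟩ : ∃ b, b = 1 + R' := ⟨_, rfl⟩
  obtain ⟨k, hk⟩ : ∃ k, k = (G₀ + L + 1) * c := ⟨_, rfl⟩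
  have hb0 : 0 ≤ b := by rw [hb]; positivity
  have hk0 : 0 ≤ k := by rw [hk]; positivity
  let B := Module.finBasis ℝ E
  let coord : Fin (Module.finrank ℝ E) → E →L[ℝ] ℝ := fun i =>
    LinearMap.toContinuousLinearMap (B.coord i)
  let f : Fin (Module.finrank ℝ E) ⊕ Fin (Module.finrank ℝ E) → E →L[ℝ] ℝ :=
    Sum.elim coord fun i => -coord i
  obtain ⟨Λ, hΛ⟩ : ∃ Λ, Λ = ∑ j, ‖f j‖ := ⟨_, rfl⟩
  have hΛ0 : 0 ≤ Λ := by rw [hΛ]; positivity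
  have hfΛ : ∀ j x, |f j x| ≤ Λ * ‖x‖ := fun j x => by
    refine ((f j).le_opNorm x).trans (mul_le_mul_of_nonneg_right ?_ (norm_nonneg _))
    rw [hΛ]
    exact Finset.single_le_sum (f := fun j => ‖f j‖) (fun _ _ => norm_nonneg _)
      (Finset.mem_univ j)
  obtain ⟨V, hV0, hV⟩ : ∃ V : ℕ → ℝ, V 0 = 0 ∧ ∀ t, V (t + 1) =
      (1 - logStepSize c ν t) ^ 2 * V t +
        logStepSize c ν t ^ 2 * (Λ * A * b * Real.exp (k * logExponent ν t)) ^ 2 :=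
    ⟨fun t => Nat.rec 0 (fun t v => (1 - logStepSize c ν t) ^ 2 * v +
      logStepSize c ν t ^ 2 * (Λ * A * b * Real.exp (k * logExponent ν t)) ^ 2) t, rfl,
      fun _ => rfl⟩
  obtain ⟨W, hW0, hVW⟩ := exists_variance_bound hν0 hν1 hc8 hk0 hV0 hV
  obtain ⟨M, hM0, hM⟩ := exists_pathwise_bound hν0 hν1 hκ0 hκ1 hc (by positivity : 0 ≤ G₀ + L)
    hA0 hb0 hk0 hG hcontr hfix hpoisson hΦb hΦlip
  obtain ⟨n, hn⟩ : ∃ n : ℝ, n = (Fintype.card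
    (Fin (Module.finrank ℝ E) ⊕ Fin (Module.finrank ℝ E)) : ℝ) := ⟨_, rfl⟩
  have hn0 : 0 ≤ n := by rw [hn]; positivity
  obtain ⟨D, hD⟩ : ∃ D, D = 1 + (∑ i, ‖B i‖) * √(2 * W) := ⟨_, rfl⟩
  have hD1 : 1 ≤ D := by
    rw [hD]
    have : 0 ≤ (∑ i, ‖B i‖) * √(2 * W) := by positivity
    linarith
  have hln : 0 ≤ Real.log (n + 1) := Real.log_nonneg (by linarith)
  refine ⟨3 * (M * D) ^ 2, Real.log (n + 1) + 4, ⌈1 / (1 - ν)⌉₊, by positivity, by positivity, ?_⟩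
  intro Ω _ μ _ ℱ Y w₀ hY hw₀ hw₀R δ hδ0 hδ1
  -- the initial point is bounded only almost surely, so it is truncated
  let w₁ : Ω → E := fun ω => {x : E | ‖x‖ ≤ R'}.indicator id (w₀ ω)
  have hball : MeasurableSet {x : E | ‖x‖ ≤ R'} := measurableSet_le measurable_norm measurable_const
  have hw₁ : Measurable[ℱ 0] w₁ := (measurable_id.indicator hball).comp hw₀
  have hw₁R : ∀ ω, ‖w₁ ω‖ ≤ R' := fun ω => by
    by_cases hω : w₀ ω ∈ {x : E | ‖x‖ ≤ R'}
    · simp only [w₁, Set.indicator_of_mem hω]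
      exact hω
    · simp only [w₁, Set.indicator_of_notMem hω, norm_zero]
      exact hR'0
  let w : Ω → ℕ → E := fun ω => saIterate H (logStepSize c ν) (w₁ ω) fun s => Y s ω
  have hw : ∀ t, Measurable[ℱ t] fun ω => w ω t :=
    measurable_saIterate hHu (logStepSize c ν) hw₁ hY.adapted
  have hwb : ∀ ω t, 1 + ‖w ω t‖ ≤ b * Real.exp (k * logExponent ν t) := fun ω t => by
    rw [hb, hk]
    exact one_add_norm_saIterate_le (by positivity) hG hν0 hν1 (by linarith) (hw₁R ω) _ t
  let m : ℕ → Ω → E := fun t ω =>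
    martingaleAverage K ψ (logStepSize c ν) (w ω) (fun s => Y s ω) t
  have hmm : ∀ t, Measurable (m t) := fun t =>
    (measurable_martingaleAverage hψu hΦu (logStepSize c ν) hw hY.adapted t).mono (ℱ.le t) le_rfl
  have hbad := measure_iUnion_ge_le (μ := μ) (X := fun j t ω => f j (m t ω)) (V := V)
    (U := fun t => W * Real.exp (-logExponent ν t))
    (fun j t => (f j).continuous.measurable.comp (hmm t)) hVW
    (fun t => mul_pos hW0 (Real.exp_pos _))
    (fun j t l => hY.lintegral_exp_martingaleAverage_le hψm hψu hΦu hw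
      (fun w => ⟨_, hψb w⟩) (f := f j)
      (fun t ω y => by
        refine (hfΛ j _).trans ?_
        have h1 := (hψb (w ω t) y).trans (mul_le_mul_of_nonneg_left (hwb ω t) hA0)
        calc _ ≤ Λ * (A * (b * Real.exp (k * logExponent ν t))) :=
              mul_le_mul_of_nonneg_left h1 hΛ0
          _ = _ := by ring) hV0 hV t l) hδ0 hδ1
  rw [← hn] at hbad
  set Bad : Set Ω := ⋃ j, ⋃ t : ℕ, {ω | √(2 * (W * Real.exp (-logExponent ν t)) * Real.log
    ((n + 1) * (((t : ℝ) + 1) * ((t : ℝ) + 2)) / δ)) ≤ f j (m t ω)} with hBad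
  set good : Set Ω := {ω | ∀ t : ℕ,
    ‖saIterate H (logStepSize c ν) (w₀ ω) (fun s => Y s ω) t - wstar‖ ^ 2 ≤
      3 * (M * D) ^ 2 * Real.exp (-logExponent ν t) *
        (Real.log (1 / δ) + (Real.log (n + 1) + 4) + logExponent ν t) ^ ⌈1 / (1 - ν)⌉₊} with hgood
  have hsub : goodᶜ ⊆ Bad ∪ {ω | ¬ ‖w₀ ω‖ ≤ R} := by
    intro ω hω
    by_contra hcon
    rw [Set.mem_union, not_or] at hcon
    obtain ⟨hωB, hωR⟩ := hcon
    refine hω ?_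
    have hωR : ‖w₀ ω‖ ≤ R := not_not.1 hωR
    have hw₁₀ : w₁ ω = w₀ ω :=
      Set.indicator_of_mem (s := {x : E | ‖x‖ ≤ R'}) (hωR.trans hRR') id
    obtain ⟨ℓ, hℓ⟩ : ∃ ℓ : ℕ → ℝ, ∀ t : ℕ,
      ℓ t = Real.log ((n + 1) * (((t : ℝ) + 1) * ((t : ℝ) + 2)) / δ) := ⟨_, fun _ => rfl⟩
    have hℓ0 : ∀ t, 0 ≤ ℓ t := fun t => by
      have ht : (0 : ℝ) ≤ t := t.cast_nonneg
      rw [hℓ]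
      refine Real.log_nonneg ?_
      rw [le_div_iff₀ hδ0]
      nlinarith [mul_nonneg ht ht, mul_nonneg hn0 (mul_nonneg ht ht), mul_nonneg hn0 ht]
    have hℓm : Monotone ℓ := fun s t hst => by
      have hst' : (s : ℝ) ≤ t := by exact_mod_cast hst
      rw [hℓ, hℓ]
      apply Real.log_le_log (by positivity)
      gcongr
    have hx : ∀ j t, f j (m t ω) < √(2 * (W * Real.exp (-logExponent ν t)) * ℓ t) := fun j t => by
      by_contra hcon
      refine hωB (Set.mem_iUnion.2 ⟨j, Set.mem_iUnion.2 ⟨t, ?_⟩⟩)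
      rw [hℓ] at hcon
      exact not_lt.1 hcon
    have hm : ∀ t, ‖m t ω‖ ≤ D * √(1 + ℓ t) * Real.exp (-logExponent ν t / 2) := fun t => by
      have hsq : √(2 * (W * Real.exp (-logExponent ν t)) * ℓ t) =
          √(2 * W) * √(ℓ t) * Real.exp (-logExponent ν t / 2) := by
        rw [Real.exp_half, ← Real.sqrt_mul (by positivity), ← Real.sqrt_mul (by
          have := hℓ0 t
          positivity)]
        congr 1
        ring
      have hcoord : ∀ i, |B.repr (m t ω) i| ≤
          √(2 * W) * √(ℓ t) * Real.exp (-logExponent ν t / 2) := fun i => by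
        rw [← hsq, abs_le]
        have h1 : B.repr (m t ω) i < _ := hx (Sum.inl i) t
        have h2 : -B.repr (m t ω) i < _ := hx (Sum.inr i) t
        constructor <;> linarith
      have h1 : ‖m t ω‖ ≤ ∑ i, |B.repr (m t ω) i| * ‖B i‖ := by
        conv_lhs => rw [← B.sum_repr (m t ω)]
        refine (norm_sum_le _ _).trans_eq (Finset.sum_congr rfl fun i _ => ?_)
        rw [norm_smul, Real.norm_eq_abs]
      have h2 : ∑ i, |B.repr (m t ω) i| * ‖B i‖ ≤
          (∑ i, ‖B i‖) * (√(2 * W) * √(ℓ t) * Real.exp (-logExponent ν t / 2)) := by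
        rw [Finset.sum_mul]
        refine Finset.sum_le_sum fun i _ => ?_
        rw [mul_comm]
        exact mul_le_mul_of_nonneg_left (hcoord i) (norm_nonneg _)
      have h3 : √(ℓ t) ≤ √(1 + ℓ t) := Real.sqrt_le_sqrt (by linarith)
      calc ‖m t ω‖ ≤ ((∑ i, ‖B i‖) * √(2 * W)) * √(ℓ t) * Real.exp (-logExponent ν t / 2) := by
            linarith
        _ ≤ D * √(1 + ℓ t) * Real.exp (-logExponent ν t / 2) := by
            gcongr
            rw [hD]
            linarith
    intro t
    have hfin := hM (w₁ ω) (fun s => Y s ω) (w ω) (fun t => D * √(1 + ℓ t)) rfl (hwb ω)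
      (fun s t hst => by
        have := hℓm hst
        dsimp only
        gcongr)
      (fun t => one_le_mul_of_one_le_of_one_le hD1 (Real.one_le_sqrt.2 (by linarith [hℓ0 t])))
      hm t
    rw [← hw₁₀]
    calc ‖w ω t - wstar‖ ^ 2
        ≤ (M * (D * √(1 + ℓ t)) * Real.exp (-logExponent ν t / 2)) ^ 2 :=
          pow_le_pow_left₀ (norm_nonneg _) hfin 2
      _ = (M * D) ^ 2 * Real.exp (-logExponent ν t) * (1 + ℓ t) := by
          have h1 : √(1 + ℓ t) ^ 2 = 1 + ℓ t := Real.sq_sqrt (by linarith [hℓ0 t])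
          have h2 : Real.exp (-logExponent ν t / 2) ^ 2 = Real.exp (-logExponent ν t) := by
            rw [← Real.exp_nat_mul]
            congr 1
            push_cast
            ring
          rw [← h2]
          calc _ = (M * D) ^ 2 * Real.exp (-logExponent ν t / 2) ^ 2 * √(1 + ℓ t) ^ 2 := by ring
            _ = _ := by rw [h1]
      _ ≤ (M * D) ^ 2 * Real.exp (-logExponent ν t) * (3 * (Real.log (1 / δ) +
            (Real.log (n + 1) + 4) + logExponent ν t) ^ ⌈1 / (1 - ν)⌉₊) := by
          gcongr
          rw [hℓ]
          exact log_union_bound_le hν0 hν1 hn0 hδ0 hδ1 t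
      _ = _ := by ring
  have hcompl : μ goodᶜ ≤ ENNReal.ofReal δ := by
    refine (measure_mono hsub).trans ((measure_union_le _ _).trans ?_)
    rw [ae_iff.1 hw₀R, add_zero]
    exact hbad
  have hcompl' : μ.real goodᶜ ≤ δ := ENNReal.toReal_le_of_le_ofReal hδ0.le hcompl
  have huniv : 1 ≤ μ.real good + μ.real goodᶜ := by
    have := measureReal_union_le (μ := μ) good goodᶜ
    rwa [Set.union_compl_self, probReal_univ] at this
  linarith
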